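/- **Setting.** Consider $n\ge 2$ asynchronous processes $p_0,\dots,p_{n-1}$ that may crash at any time and communicate by atomic instructions (Read, Write, or Read-Modify-Write) on shared base objects. An algorithm consists of local state machines; an execution is a sequence of invocations and responses of high-level operations and of steps (instructions of base objects), in which each process executes one operation at a time as prescribed by its machine. Process $p_0$ is the owner and may invoke $\mathsf{Put}(x)$, $x\in\mathbf N=\{1,2,\dots\}$, and $\mathsf{Take}()$; every other process is a thief and may invoke $\mathsf{Steal}()$. **The algorithm WS-WMULT.** Shared Read/Write objects: $R$, initially $1$, and an infinite array $Tasks[1,2,\dots]$ whose entries hold a task or $\bot$, with $Tasks[1]=Tasks[2]=\bot$ initially and the other entries initially arbitrary. Each process has a persistent local variable $r$, initially $1$; the owner has a persistent local variable $tail$, initially $0$. Instructions between braces may be executed in any order (interleaved arbitrarily). - $\mathsf{RMaxRead}()$: $r\leftarrow\max\{r,R.\mathsf{Read}()\}$; return $r$. - $\mathsf{RMaxWrite}(x)$: $r\leftarrow\max\{r,R.\mathsf{Read}()\}$; if $x>r$ then $\{r\leftarrow x,\ R.\mathsf{Write}(x)\}$; return $\mathsf{true}$. - $\mathsf{Put}(x)$: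 $tail\leftarrow tail+1$; $\{Tasks[tail].\mathsf{Write}(x),\ Tasks[tail+2].\mathsf{Write}(\bot)\}$; return $\mathsf{true}$. - $\mathsf{Take}()$: $head\leftarrow\mathsf{RMaxRead}()$; if $head\le tail$ then $\{x\leftarrow Tasks[head].\mathsf{Read}(),\ \mathsf{RMaxWrite}(head+1)\}$ and return $x$; otherwise return $\mathsf{empty}$. - $\mathsf{Steal}()$: $head\leftarrow\mathsf{RMaxRead}()$; $x\leftarrow Tasks[head].\mathsf{Read}()$; if $x\ne\bot$ then $\mathsf{RMaxWrite}(head+1)$ and return $x$; otherwise return $\mathsf{empty}$. **Specifications.** *FIFO work-stealing*: the state is a finite string of tasks, initially empty; $\mathsf{Put}(x)$ appends $x$ and returns $\mathsf{true}$; $\mathsf{Take}$ and $\mathsf{Steal}$ remove and return the first task, or return $\mathsf{empty}$ if the string is empty. *(FIFO) work-stealing with weak multiplicity*: the state is a vector $(t_0,\dots,t_{n-1})$ of finite strings of tasks such that of any two of them one is a suffix of the other, initially all empty. $\mathsf{Put}(x)$ appends $x$ to every $t_i$ and returns $\mathsf{true}$. A $\mathsf{Take}$ ($i=0$) or $\mathsf{Steal}$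 ($i\ge1$) by $p_i$ returns $\mathsf{empty}$ and changes nothing if $t_i$ is empty. Otherwise write $t_i=x_1\cdots x_j\cdot q$ with $j\ge1$ and $x_j\cdot q$ the shortest string of the vector (if that string is empty, $x_j$ and $q$ are both empty); the operation returns $x_k$ for an arbitrary $k\in\{1,\dots,j\}$ (an empty $x_k$ meaning the response $\mathsf{empty}$), and $t_i$ becomes $x_{k+1}\cdots x_j\cdot q$. **Theorem.** There is a constant $c$ such that for every $n\ge2$ the algorithm WS-WMULT for $n$ processes has the following properties. 1. (*Fully Read/Write*) It uses only Read and Write instructions. 2. (*Fence-free*) It imposes no ordering among the steps of an operation beyond data dependence: whenever in an operation an instruction $b$ can directly follow an instruction $a$ on a different base object and is executed, unchanged, whatever value $a$ returns, the algorithm also admits the order $b$, $a$, with the same resulting local state. All the other properties hold for all the orders admitted. 3. (*Wait-free*) If a process takes infinitely many steps in an execution, all its invocations are completed (and a process in the middle of an operation always has an instruction to execute or a response to return). 4. (*Sequentially-exact*) In every finite execution in which no two operations, completed or pending, are concurrent, the completed operations with their responses, in the order of the execution, form a sequential execution of FIFO work-stealing. 5. (*Linearizable*) For every finite execution $E$ there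 is a sequential execution of work-stealing with weak multiplicity that contains every completed operation of $E$ and possibly some pending ones, each once and with the inputs and outputs of $E$, in which an operation that responds in $E$ before another one is invoked never comes after it. 6. (*Constant step complexity*) In every execution every operation executes at most $c$ steps. -/

import Mathlib

namespace WorkStealing

/-! ### Shared memory model

A shared memory is a family of base objects indexed by `Loc`; the object `l` holds a value of
type `Val l`. -/

section Model

variable {Loc : Type}

/-- Atomic instructions of base objects.  `rmw l f` is a general Read-Modify-Write instruction: it
atomically replaces the content `v` of `l` by `f v` and returns `v` (Swap, Compare&Swap,
Test&Set, Fetch&Increment, ... are of this form). -/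
inductive Instr (Val : Loc → Type) : Type
  | read (l : Loc)
  | write (l : Loc) (v : Val l)
  | rmw (l : Loc) (f : Val l → Val l)

namespace Instr

variable {Val : Loc → Type}

/-- The base object that is accessed. -/
def loc : Instr Val → Loc
  | read l => l
  | write l _ => l
  | rmw l _ => l

/-- The type of the value that an instruction returns to the process. -/
@[reducible] def Resp : Instr Val → Type
  | read l => Val l
  | write _ _ => Unit
  | rmw l _ => Val l

/-- The value returned by an instruction that is executed in memory `m`. -/
def resp (m : (l : Loc) → Val l) : (a : Instr Val) → a.Resp
  | read l => m l
  | write _ _ => ()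
  | rmw l _ => m l

/-- The memory after an instruction has been executed in memory `m`. -/
def apply [DecidableEq Loc] (m : (l : Loc) → Val l) : Instr Val → ((l : Loc) → Val l)
  | read _ => m
  | write l v => Function.update m l v
  | rmw l f => Function.update m l (f (m l))

/-- The simple Read/Write instructions. -/
def IsReadWrite : Instr Val → Prop
  | read _ => True
  | write _ _ => True
  | rmw _ _ => False

end Instr

/-- An algorithm for `n` processes over base objects `Val`, with high-level operations (and their
inputs) `Op` and responses `Res`.

While process `i` executes no operation, its local state is the value (of type `Pers`) of its
persistent local variables.  When it invokes `op` it moves to the control state `start i op p`.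
In control state `c` it executes next any one of the instructions in `instr c` (several of them, if
the algorithm leaves their order open), and moves to `next c a r` if the instruction `a` returned
`r`.  When `out c = some (v, p)`, the operation responds `v` and the persistent variables become
`p`.  By `live`, the machine is never stuck, and it does nothing after its operation is over. -/
structure Algorithm (n : ℕ) (Val : Loc → Type) (Op Res : Type) where
  /-- which operations a process is entitled to invoke -/
  mayInvoke : Fin n → Op → Prop
  /-- the admissible initial contents of the shared memory -/
  initMem : ((l : Loc) → Val l) → Prop
  Pers : Type
  initPers : Fin n → Pers
  Ctl : Type
  start : Fin n → Op → Pers → Ctl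
  instr : Ctl → Set (Instr Val)
  next : Ctl → (a : Instr Val) → a.Resp → Ctl
  out : Ctl → Option (Res × Pers)
  live : ∀ c, out c = none ↔ (instr c).Nonempty

/-- The events of an execution: invocations, steps (instructions of base objects), responses. -/
inductive Event (n : ℕ) (Val : Loc → Type) (Op Res : Type) : Type
  | inv (i : Fin n) (op : Op)
  | step (i : Fin n) (a : Instr Val)
  | res (i : Fin n) (v : Res)

/-- The process to which an event belongs. -/
def Event.proc {n : ℕ} {Val : Loc → Type} {Op Res : Type} : Event n Val Op Res → Fin n
  | inv i _ => i
  | step i _ => i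
  | res i _ => i

namespace Algorithm

variable {n : ℕ} {Val : Loc → Type} {Op Res : Type}

/-- Local state of a process: between two operations, or inside an operation. -/
inductive Local (A : Algorithm n Val Op Res) : Type
  | idle (p : A.Pers)
  | busy (c : A.Ctl)

/-- Global configurations. -/
structure Config (A : Algorithm n Val Op Res) : Type where
  mem : (l : Loc) → Val l
  proc : Fin n → A.Local

/-- Initial configurations. -/
def Initial (A : Algorithm n Val Op Res) (C : A.Config) : Prop :=
  A.initMem C.mem ∧ ∀ i, C.proc i = .idle (A.initPers i)

/-- `A.Trans C e C'`: event `e` can happen in configuration `C` and leads to `C'`. -/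
inductive Trans [DecidableEq Loc] (A : Algorithm n Val Op Res) :
    A.Config → Event n Val Op Res → A.Config → Prop
  | inv {C : A.Config} {i : Fin n} {p : A.Pers} {op : Op}
      (hi : C.proc i = .idle p) (hop : A.mayInvoke i op) :
      Trans A C (.inv i op) ⟨C.mem, Function.update C.proc i (.busy (A.start i op p))⟩
  | step {C : A.Config} {i : Fin n} {c : A.Ctl} {a : Instr Val}
      (hi : C.proc i = .busy c) (ha : a ∈ A.instr c) :
      Trans A C (.step i a)
        ⟨a.apply C.mem, Function.update C.proc i (.busy (A.next c a (a.resp C.mem)))⟩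
  | res {C : A.Config} {i : Fin n} {c : A.Ctl} {v : Res} {p : A.Pers}
      (hi : C.proc i = .busy c) (hv : A.out c = some (v, p)) :
      Trans A C (.res i v) ⟨C.mem, Function.update C.proc i (.idle p)⟩

/-- Finite runs between configurations. -/
inductive Run [DecidableEq Loc] (A : Algorithm n Val Op Res) :
    A.Config → List (Event n Val Op Res) → A.Config → Prop
  | nil (C : A.Config) : Run A C [] C
  | snoc {C C' C'' : A.Config} {E : List (Event n Val Op Res)} {e : Event n Val Op Res}
      (hE : Run A C E C') (he : A.Trans C' e C'') : Run A C (E ++ [e]) C''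

/-- Finite executions. -/
def IsExecution [DecidableEq Loc] (A : Algorithm n Val Op Res)
    (E : List (Event n Val Op Res)) : Prop :=
  ∃ C C' : A.Config, A.Initial C ∧ A.Run C E C'

/-- Infinite executions. -/
def IsInfExecution [DecidableEq Loc] (A : Algorithm n Val Op Res)
    (e : ℕ → Event n Val Op Res) : Prop :=
  ∃ C : ℕ → A.Config, A.Initial (C 0) ∧ ∀ k, A.Trans (C k) (e k) (C (k + 1))

/-- Control states that a process can reach inside an operation, whatever its instructions
return. -/
inductive Reach (A : Algorithm n Val Op Res) : A.Ctl → Prop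
  | start {i : Fin n} {op : Op} (hop : A.mayInvoke i op) (p : A.Pers) : Reach A (A.start i op p)
  | next {c : A.Ctl} {a : Instr Val} (hc : Reach A c) (ha : a ∈ A.instr c) (r : a.Resp) :
      Reach A (A.next c a r)

/-- Only simple Read and Write instructions are used. -/
def FullyReadWrite (A : Algorithm n Val Op Res) : Prop :=
  ∀ c, A.Reach c → ∀ a ∈ A.instr c, a.IsReadWrite

/-- Instruction `b`, which can directly follow `a` from control state `c`, is not data-dependent on
`a`: it accesses another base object, and it is the same instruction and is executed whatever the
value that `a` returns. -/
def Independent (A : Algorithm n Val Op Res) (c : A.Ctl) (a b : Instr Val) : Prop :=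
  a.loc ≠ b.loc ∧ ∀ r : a.Resp, b ∈ A.instr (A.next c a r)

/-- No ordering among the steps of an operation is imposed beyond data dependence: whenever `b` can
follow `a` and does not depend on it, the algorithm also admits `b` before `a`, with the same effect
on the local state.  (A write returns no information, so in particular a read of another object is
never required to come after a write.) -/
def FenceFree (A : Algorithm n Val Op Res) : Prop :=
  ∀ c, A.Reach c → ∀ a ∈ A.instr c, ∀ b, A.Independent c a b →
    b ∈ A.instr c ∧ ∀ (r : a.Resp) (s : b.Resp),
      a ∈ A.instr (A.next c b s) ∧ A.next (A.next c b s) a r = A.next (A.next c a r) b s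

/-- If a process takes infinitely many steps, then all its invocations are completed. -/
def WaitFree [DecidableEq Loc] (A : Algorithm n Val Op Res) : Prop :=
  ∀ e, A.IsInfExecution e → ∀ i, {k | (e k).proc = i}.Infinite →
    ∀ k op, e k = .inv i op → ∃ m, k < m ∧ ∃ v, e m = .res i v

end Algorithm

/-! ### Operations of an execution

An operation of a finite sequence of events is identified by the position of its invocation. -/

section Operations

variable {n : ℕ} {Val : Loc → Type} {Op Res : Type}

/-- The operation invoked at position `k` responds `v` at position `m`. -/
def RespondsAt (E : List (Event n Val Op Res)) (k m : ℕ) (v : Res) : Prop :=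
  ∃ i op, E[k]? = some (.inv i op) ∧ k < m ∧ E[m]? = some (.res i v) ∧
    ∀ j w, k < j → j < m → E[j]? ≠ some (.res i w)

/-- The positions of the steps executed by the operation invoked at position `k`. -/
def stepsOf (E : List (Event n Val Op Res)) (k : ℕ) : Set ℕ :=
  {m | ∃ i op a, E[k]? = some (.inv i op) ∧ k < m ∧ E[m]? = some (.step i a) ∧
    ∀ j w, k < j → j < m → E[j]? ≠ some (.res i w)}

/-- Real-time order: operation `k` has responded before operation `k'` is invoked. -/
def Precedes (E : List (Event n Val Op Res)) (k k' : ℕ) : Prop :=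
  (∃ i op, E[k']? = some (.inv i op)) ∧ ∃ m v, RespondsAt E k m v ∧ m < k'

/-- No two operations, completed or pending, are concurrent. -/
def IsSequential (E : List (Event n Val Op Res)) : Prop :=
  ∀ k k' i i' op op', E[k]? = some (.inv i op) → E[k']? = some (.inv i' op') →
    k < k' → Precedes E k k'

/-- An operation together with a response: position of its invocation, process, operation,
response. -/
structure OpRecord (n : ℕ) (Op Res : Type) where
  pos : ℕ
  proc : Fin n
  op : Op
  res : Res

/-- `o` is a completed operation of `E`. -/
def IsCompleted (E : List (Event n Val Op Res)) (o : OpRecord n Op Res) : Prop :=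
  E[o.pos]? = some (.inv o.proc o.op) ∧ ∃ m, RespondsAt E o.pos m o.res

/-- `o` is a pending operation of `E`, together with some response. -/
def IsPending (E : List (Event n Val Op Res)) (o : OpRecord n Op Res) : Prop :=
  E[o.pos]? = some (.inv o.proc o.op) ∧ ∀ m v, ¬ RespondsAt E o.pos m v

end Operations

/-! ### Sequential specifications and correctness conditions -/

/-- A (possibly non-deterministic) sequential specification.  `δ q i op v q'`: in state `q`, the
operation `op` of process `i` can respond `v` and move to `q'`. -/
structure SeqSpec (n : ℕ) (Op Res : Type) where
  Q : Type
  init : Q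
  δ : Q → Fin n → Op → Res → Q → Prop

namespace SeqSpec

variable {n : ℕ} {Op Res : Type}

/-- `T.Accepts q S`: the state machine can produce, from state `q`, the sequence `S` of invocations
with their responses. -/
def Accepts (T : SeqSpec n Op Res) : T.Q → List (OpRecord n Op Res) → Prop
  | _, [] => True
  | q, o :: S => ∃ q', T.δ q o.proc o.op o.res q' ∧ T.Accepts q' S

/-- Sequential executions of the object. -/
def IsSeqExecution (T : SeqSpec n Op Res) (S : List (OpRecord n Op Res)) : Prop :=
  T.Accepts T.init S

end SeqSpec

section Correctness

variable {n : ℕ} {Val : Loc → Type} {Op Res : Type}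

/-- `S` is a linearization of `E` with respect to `T`: a sequential execution of `T` with all
completed operations of `E` and possibly some pending ones, each at most once, that respects the
real-time order of `E`. -/
def IsLinearization (T : SeqSpec n Op Res) (E : List (Event n Val Op Res))
    (S : List (OpRecord n Op Res)) : Prop :=
  T.IsSeqExecution S ∧
  (S.map OpRecord.pos).Nodup ∧
  (∀ o ∈ S, IsCompleted E o ∨ IsPending E o) ∧
  (∀ o, IsCompleted E o → o ∈ S) ∧
  S.Pairwise fun o o' => ¬ Precedes E o'.pos o.pos

namespace Algorithm

/-- Every finite execution has a linearization. -/
def Linearizable [DecidableEq Loc] (A : Algorithm n Val Op Res) (T : SeqSpec n Op Res) : Prop :=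
  ∀ E, A.IsExecution E → ∃ S, IsLinearization T E S

/-- In every execution without concurrent operations, the completed operations with their responses,
in the order in which they happen, form a sequential execution of the exact specification `T`. -/
def SequentiallyExact [DecidableEq Loc] (A : Algorithm n Val Op Res) (T : SeqSpec n Op Res) :
    Prop :=
  ∀ E, A.IsExecution E → IsSequential E →
    ∃ S : List (OpRecord n Op Res), S.Pairwise (fun o o' => o.pos < o'.pos) ∧
      (∀ o, o ∈ S ↔ IsCompleted E o) ∧ T.IsSeqExecution S

/-- In every execution, every operation executes at most `c` steps. -/
def StepComplexityLE [DecidableEq Loc] (A : Algorithm n Val Op Res) (c : ℕ) : Prop :=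
  ∀ E, A.IsExecution E → ∀ k, (stepsOf E k).encard ≤ c

end Algorithm

end Correctness

end Model

/-! ### Work-stealing objects

Tasks are positive integers.  Process `0` is the owner, the other processes are thieves. -/

inductive WSOp : Type
  | put (x : ℕ+)
  | take
  | steal

inductive WSRes : Type
  | ok                -- the response `true` of `put`
  | task (x : ℕ+)
  | empty

/-- Only the owner may put and take, only thieves may steal. -/
def WSOp.MayInvoke {n : ℕ} (i : Fin n) : WSOp → Prop
  | put _ => i.val = 0
  | take => i.val = 0
  | steal => i.val ≠ 0

/-- Transitions of exact FIFO work-stealing; the state is the queue of tasks, head first. -/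
inductive FifoStep (n : ℕ) : List ℕ+ → Fin n → WSOp → WSRes → List ℕ+ → Prop
  | put {q : List ℕ+} {i : Fin n} {x : ℕ+} (hi : i.val = 0) :
      FifoStep n q i (.put x) .ok (q ++ [x])
  | take {q : List ℕ+} {i : Fin n} {x : ℕ+} (hi : i.val = 0) :
      FifoStep n (x :: q) i .take (.task x) q
  | steal {q : List ℕ+} {i : Fin n} {x : ℕ+} (hi : i.val ≠ 0) :
      FifoStep n (x :: q) i .steal (.task x) q
  | takeEmpty {i : Fin n} (hi : i.val = 0) : FifoStep n [] i .take .empty []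
  | stealEmpty {i : Fin n} (hi : i.val ≠ 0) : FifoStep n [] i .steal .empty []

/-- (FIFO) work-stealing. -/
def fifoWorkStealing (n : ℕ) : SeqSpec n WSOp WSRes where
  Q := List ℕ+
  init := []
  δ := FifoStep n

/-- States of work-stealing with weak multiplicity: one string of tasks per process, such that of
any two strings one is a suffix of the other. -/
def WeakState (n : ℕ) : Type :=
  {t : Fin n → List ℕ+ // ∀ i j, t i <:+ t j ∨ t j <:+ t i}

/-- `s` is the shortest string of the state `t`. -/
def WeakState.IsShortest {n : ℕ} (t : WeakState n) (s : List ℕ+) : Prop :=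
  (∃ m, t.1 m = s) ∧ ∀ l, s.length ≤ (t.1 l).length

/-- `t.Extract i v t'`: process `i`, whose string is not empty, extracts `v` from the state `t`.
Writing its string as `x₁ ⋯ x_j · q`, with `x_j · q` the shortest string of `t`, the response is
some `x_k` with `1 ≤ k ≤ j`, and the string becomes `x_{k+1} ⋯ x_j · q`; if the shortest string
is empty (so that `x_j` and `q` are empty), the choice `k = j` yields the response `empty`. -/
inductive WeakState.Extract {n : ℕ} (t : WeakState n) (i : Fin n) : WSRes → WeakState n → Prop
  | task {u w s : List ℕ+} {x : ℕ+} {t' : WeakState n}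
      (ht : t.1 i = u ++ x :: w) (hs : t.IsShortest s) (hsx : s <:+ x :: w)
      (ht' : t'.1 = Function.update t.1 i w) : Extract t i (.task x) t'
  | empty {t' : WeakState n} (ht : t.1 i ≠ []) (hs : t.IsShortest [])
      (ht' : t'.1 = Function.update t.1 i []) : Extract t i .empty t'

/-- Transitions of (FIFO) work-stealing with weak multiplicity. -/
inductive WeakStep (n : ℕ) : WeakState n → Fin n → WSOp → WSRes → WeakState n → Prop
  | put {t t' : WeakState n} {i : Fin n} {x : ℕ+} (hi : i.val = 0)
      (ht' : ∀ l, t'.1 l = t.1 l ++ [x]) : WeakStep n t i (.put x) .ok t'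
  | take {t t' : WeakState n} {i : Fin n} {v : WSRes} (hi : i.val = 0)
      (h : t.Extract i v t') : WeakStep n t i .take v t'
  | steal {t t' : WeakState n} {i : Fin n} {v : WSRes} (hi : i.val ≠ 0)
      (h : t.Extract i v t') : WeakStep n t i .steal v t'
  | takeEmpty {t : WeakState n} {i : Fin n} (hi : i.val = 0) (ht : t.1 i = []) :
      WeakStep n t i .take .empty t
  | stealEmpty {t : WeakState n} {i : Fin n} (hi : i.val ≠ 0) (ht : t.1 i = []) :
      WeakStep n t i .steal .empty t

/-- (FIFO) work-stealing with weak multiplicity. -/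
def weakWorkStealing (n : ℕ) : SeqSpec n WSOp WSRes where
  Q := WeakState n
  init := ⟨fun _ => [], fun _ _ => Or.inl List.suffix_rfl⟩
  δ := WeakStep n

/-! ### The algorithm WS-WMULT, with the RangeMaxRegister algorithm for `Head`

Base objects: the object `R` of the RangeMaxRegister, and the array `Tasks` (entry `0` is not
used), whose entries hold a task or `⊥`. -/

inductive WSLoc : Type
  | R
  | tasks (i : ℕ)
  deriving DecidableEq

@[reducible] def WSVal : WSLoc → Type
  | .R => ℕ
  | .tasks _ => Option ℕ+

/-- Control states of a call `RMaxWrite(x)` of a process whose persistent variable is `r`: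
```
r ← max {r, R.Read()}            -- state `read x r`
if x > r then
  {r ← x, R.Write(x)}            -- state `write x`
return true                      -- state `ret r`
``` -/
inductive RMaxWrite : Type
  | read (x r : ℕ)
  | write (x : ℕ)
  | ret (r : ℕ)

namespace RMaxWrite

def instr : RMaxWrite → Set (Instr WSVal)
  | read _ _ => {.read .R}
  | write x => {.write .R x}
  | ret _ => ∅

/-- `R.Read()` has returned `v`. -/
def onRead (v : ℕ) : RMaxWrite → RMaxWrite
  | read x r => if max r v < x then write x else ret (max r v)
  | w => w

/-- `R.Write(x)` has been executed. -/
def onWrite : RMaxWrite → RMaxWrite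
  | write x => ret x
  | w => w

end RMaxWrite

/-- Persistent local variables: `r` of the RangeMaxRegister algorithm (every process), and `tail` of
the owner (not used by thieves). -/
structure WSPers : Type where
  r : ℕ
  tail : ℕ

/-- Control states of the three operations:
```
Put(x):   tail ← tail + 1
          {Tasks[tail].Write(x), Tasks[tail + 2].Write(⊥)}       -- state `put`
          return true
Take():   head ← Head.RMaxRead()                                 -- state `takeHead`
          if head ≤ tail then
            {x ← Tasks[head].Read(), Head.RMaxWrite(head + 1)}   -- state `takeBody`
            return x
          return empty
Steal():  head ← Head.RMaxRead()                                 -- state `stealHead`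
          x ← Tasks[head].Read()                                 -- state `stealTask`
          if x ≠ ⊥ then
            Head.RMaxWrite(head + 1)                             -- state `stealWrite`
            return x
          return empty
```
where `RMaxRead()` is: `r ← max {r, R.Read()}; return r`, and the instructions between braces may be
executed in any order. -/
inductive WSCtl : Type
  /-- `tail` is already incremented; the Booleans tell which of the two writes are done -/
  | put (p : WSPers) (x : ℕ+) (doneTask doneBot : Bool)
  | takeHead (p : WSPers)
  /-- `x = none` as long as `Tasks[head]` has not been read; `w` is the state of `RMaxWrite` -/
  | takeBody (p : WSPers) (head : ℕ) (x : Option (Option ℕ+)) (w : RMaxWrite)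
  | stealHead (p : WSPers)
  | stealTask (p : WSPers) (head : ℕ)
  | stealWrite (p : WSPers) (x : ℕ+) (w : RMaxWrite)
  /-- about to return `empty` -/
  | retEmpty (p : WSPers)

namespace WSCtl

def start : WSOp → WSPers → WSCtl
  | .put x, p => put { p with tail := p.tail + 1 } x false false
  | .take, p => takeHead p
  | .steal, p => stealHead p

def instr : WSCtl → Set (Instr WSVal)
  | put p x dT dB => {a | (dT = false ∧ a = .write (.tasks p.tail) (some x)) ∨
      (dB = false ∧ a = .write (.tasks (p.tail + 2)) none)}
  | takeHead _ => {.read .R}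
  | takeBody _ head x w => {a | (x = none ∧ a = .read (.tasks head)) ∨ a ∈ w.instr}
  | stealHead _ => {.read .R}
  | stealTask _ head => {.read (.tasks head)}
  | stealWrite _ _ w => w.instr
  | retEmpty _ => ∅

/-- The last case collects the pairs for which the instruction is not one of the control state. -/
def next : WSCtl → (a : Instr WSVal) → a.Resp → WSCtl
  | put p x dT dB, .write (.tasks i) _, _ =>
      if i = p.tail then put p x true dB else put p x dT true
  | takeHead p, .read .R, v =>
      let head := max p.r v
      let p' : WSPers := { p with r := head }
      if head ≤ p.tail then takeBody p' head none (.read (head + 1) head) else retEmpty p'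
  | takeBody p head _ w, .read (.tasks _), y => takeBody p head (some y) w
  | takeBody p head x w, .read .R, v => takeBody p head x (w.onRead v)
  | takeBody p head x w, .write .R _, _ => takeBody p head x w.onWrite
  | stealHead p, .read .R, v =>
      let head := max p.r v
      stealTask { p with r := head } head
  | stealTask p head, .read (.tasks _), y =>
      match y with
      | some x => stealWrite p x (.read (head + 1) p.r)
      | none => retEmpty p
  | stealWrite p x w, .read .R, v => stealWrite p x (w.onRead v)
  | stealWrite p x w, .write .R _, _ => stealWrite p x w.onWrite
  | c, _, _ => c

/-- In the case of `takeBody`, the value read from `Tasks[head]` is returned (`⊥` as `empty`). -/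
def out : WSCtl → Option (WSRes × WSPers)
  | put p _ true true => some (.ok, p)
  | takeBody p _ (some (some x)) (.ret r) => some (.task x, { p with r := r })
  | takeBody p _ (some none) (.ret r) => some (.empty, { p with r := r })
  | stealWrite p x (.ret r) => some (.task x, { p with r := r })
  | retEmpty p => some (.empty, p)
  | _ => none

theorem live (c : WSCtl) : c.out = none ↔ c.instr.Nonempty := by
  rcases c with ⟨p, x, _ | _, _ | _⟩ | p | ⟨p, h, _ | _ | x, w | w | w⟩ | p | ⟨p, h⟩ |
    ⟨p, x, w | w | w⟩ | p <;>
  simp [out, instr, RMaxWrite.instr, Set.Nonempty]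

end WSCtl

/-- WS-WMULT for `n` processes, in which `Head` is an instance of the RangeMaxRegister algorithm.
Initially `R = 1`, `Tasks[1] = Tasks[2] = ⊥` (the other entries are arbitrary), `r = 1` and
`tail = 0`. -/
def wsWMult (n : ℕ) : Algorithm n WSVal WSOp WSRes where
  mayInvoke := WSOp.MayInvoke
  initMem := fun m => m .R = 1 ∧ m (.tasks 1) = none ∧ m (.tasks 2) = none
  Pers := WSPers
  initPers := fun _ => ⟨1, 0⟩
  Ctl := WSCtl
  start := fun _ op p => WSCtl.start op p
  instr := WSCtl.instr
  next := WSCtl.next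
  out := WSCtl.out
  live := WSCtl.live

end WorkStealing

namespace WorkStealing

/-! ### Unanswered invocations -/

section Unanswered

variable {Loc : Type} {n : ℕ} {Val : Loc → Type} {Op Res : Type}

/-! Let `xs` be the list of tasks written to the array so far and `g l` the number of them that
process `l` has discarded. The strings `xs.drop (g l)` form the state of weak multiplicity that
corresponds to a configuration. The register `R` may lose writes and even decrease, yet no value
held by `R` or used as a head exceeds `max g + 1` (`Reached`), whereas the local `r` of process `i`
exceeds `g i` whenever it starts an operation (`WeakPers`). So the index `head - 1` selected by
process `i` lies between `g i` and `max g`: the entry is not yet discarded by `i` and is not beyond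
the first task of the shortest string. This is exactly the freedom that the specification grants
(`WeakState.Drops.extract_task`, `WeakState.Drops.extract_empty`).

The array satisfies `TaskInv`: entries `1, …, |xs|` hold the tasks for good and entry `|xs| + 1` is
`⊥`. Since heads never exceed `|xs| + 1` when a thief reads, the arbitrary entries are never seen,
and reading `⊥` means that all of `xs` has been passed. Between operations of the owner entry `|xs|
+ 2` is `⊥` as well; this spare cell makes the order of the two writes of `Put` irrelevant.

Every operation has a fixed linearization point: `Put` at the write of its task, `Take` at its first
read of `R` (only the owner changes `tail`, and written entries are stable, so the result is already
determined), `Steal` at its read of the array. An operation appended to the linearization while it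
is unanswered cannot violate the real-time order, so a forward simulation suffices
(`Simulation.exists_tracks`). Without concurrency a single counter `g` with `R = g + 1` replaces the
vector, every extraction takes the true first task, and the same machinery applies to the FIFO
queue.

Wait-freedom and the bound on steps come from one decreasing measure, `WSCtl.fuel`; the constant is
4. Fence-freedom is a case analysis of the control states: the only independent pairs are the two
writes of `Put`, and the array read of `Take` against the steps of its `RMaxWrite`. -/

theorem getElem?_snoc_eq_some {α : Type*} (E : List α) (e x : α) (k : ℕ) :
    (E ++ [e])[k]? = some x ↔ E[k]? = some x ∨ (k = E.length ∧ e = x) := by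
  rcases lt_trichotomy k E.length with h | h | h
  · rw [List.getElem?_append_left h]
    exact ⟨Or.inl, fun h' => h'.resolve_right fun h'' => h.ne h''.1⟩
  · subst h; simp
  · have h1 : E[k]? = none := List.getElem?_eq_none h.le
    have h2 : (E ++ [e])[k]? = none := List.getElem?_eq_none (by simpa using h)
    simp [h1, h2, h.ne']

/-- The operation `op` of process `i`, invoked at position `k`, has not responded. -/
def Unanswered (E : List (Event n Val Op Res)) (i : Fin n) (k : ℕ) (op : Op) : Prop :=
  E[k]? = some (.inv i op) ∧ ∀ j w, k < j → E[j]? ≠ some (.res i w)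

variable {E : List (Event n Val Op Res)} {e : Event n Val Op Res}

theorem lt_length_of_getElem? {α : Type*} {E : List α} {k : ℕ} {x : α} (h : E[k]? = some x) :
    k < E.length :=
  (List.getElem?_eq_some_iff.1 h).1

theorem RespondsAt.not_unanswered {k m : ℕ} {v : Res} {i : Fin n} {op : Op}
    (h : RespondsAt E k m v) : ¬ Unanswered E i k op := by
  rintro ⟨h1, h2⟩
  obtain ⟨i', op', h3, h4, h5, -⟩ := h
  rw [h1] at h3
  cases h3
  exact h2 m v h4 h5

/-- If the process has any response event after the invocation, the first such event answers the
invocation. So having no matching response is the same as having no later response at all, a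
condition that is easy to follow event by event. -/
theorem isPending_iff (o : OpRecord n Op Res) :
    IsPending E o ↔ Unanswered E o.proc o.pos o.op := by
  classical
  constructor
  · rintro ⟨h1, h2⟩
    refine ⟨h1, fun j w hj hw => ?_⟩
    have hex : ∃ j, o.pos < j ∧ ∃ w, E[j]? = some (.res o.proc w) := ⟨j, hj, w, hw⟩
    obtain ⟨hlt, w', hw'⟩ := Nat.find_spec hex
    refine h2 (Nat.find hex) w' ⟨o.proc, o.op, h1, hlt, hw', fun j' u hj' hlt' hu => ?_⟩
    exact Nat.find_min hex hlt' ⟨hj', u, hu⟩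
  · exact fun h => ⟨h.1, fun m v hm => hm.not_unanswered h⟩

theorem respondsAt_snoc {k m : ℕ} {v : Res} :
    RespondsAt (E ++ [e]) k m v ↔ RespondsAt E k m v ∨
      (m = E.length ∧ ∃ i op, Unanswered E i k op ∧ e = .res i v) := by
  constructor
  · rintro ⟨i, op, h1, h2, h3, h4⟩
    rw [getElem?_snoc_eq_some] at h1 h3
    have h5 : E[k]? = some (.inv i op) := by
      rcases h1 with h1 | ⟨rfl, -⟩
      · exact h1
      · rcases h3 with h3 | ⟨rfl, -⟩
        · have := lt_length_of_getElem? h3; omega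
        · omega
    rcases h3 with h3 | ⟨rfl, rfl⟩
    · exact Or.inl ⟨i, op, h5, h2, h3, fun j w hj hm hE =>
        h4 j w hj hm ((getElem?_snoc_eq_some _ _ _ _).2 (Or.inl hE))⟩
    · exact Or.inr ⟨rfl, i, op, ⟨h5, fun j w hj hE => h4 j w hj (lt_length_of_getElem? hE)
        ((getElem?_snoc_eq_some _ _ _ _).2 (Or.inl hE))⟩, rfl⟩
  · rintro (⟨i, op, h1, h2, h3, h4⟩ | ⟨rfl, i, op, ⟨h1, h2⟩, rfl⟩)
    · refine ⟨i, op, (getElem?_snoc_eq_some _ _ _ _).2 (Or.inl h1), h2,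
        (getElem?_snoc_eq_some _ _ _ _).2 (Or.inl h3), fun j w hj hm hE => ?_⟩
      rcases (getElem?_snoc_eq_some _ _ _ _).1 hE with hE | ⟨rfl, -⟩
      · exact h4 j w hj hm hE
      · have := lt_length_of_getElem? h3; omega
    · refine ⟨i, op, (getElem?_snoc_eq_some _ _ _ _).2 (Or.inl h1), lt_length_of_getElem? h1,
        (getElem?_snoc_eq_some _ _ _ _).2 (Or.inr ⟨rfl, rfl⟩), fun j w hj hm hE => ?_⟩
      rcases (getElem?_snoc_eq_some _ _ _ _).1 hE with hE | ⟨rfl, -⟩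
      · exact h2 j w hj hE
      · omega

theorem unanswered_snoc {i : Fin n} {k : ℕ} {op : Op} :
    Unanswered (E ++ [e]) i k op ↔
      (Unanswered E i k op ∧ ∀ w, e ≠ .res i w) ∨ (k = E.length ∧ e = .inv i op) := by
  constructor
  · rintro ⟨h1, h2⟩
    rcases (getElem?_snoc_eq_some _ _ _ _).1 h1 with h1 | ⟨rfl, rfl⟩
    · exact Or.inl ⟨⟨h1, fun j w hj hE => h2 j w hj ((getElem?_snoc_eq_some _ _ _ _).2 (Or.inl hE))⟩,
        fun w hw => h2 E.length w (lt_length_of_getElem? h1)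
          ((getElem?_snoc_eq_some _ _ _ _).2 (Or.inr ⟨rfl, hw⟩))⟩
    · exact Or.inr ⟨rfl, rfl⟩
  · rintro (⟨⟨h1, h2⟩, h3⟩ | ⟨rfl, rfl⟩)
    · refine ⟨(getElem?_snoc_eq_some _ _ _ _).2 (Or.inl h1), fun j w hj hE => ?_⟩
      rcases (getElem?_snoc_eq_some _ _ _ _).1 hE with hE | ⟨-, hE⟩
      · exact h2 j w hj hE
      · exact h3 w hE
    · refine ⟨(getElem?_snoc_eq_some _ _ _ _).2 (Or.inr ⟨rfl, rfl⟩), fun j w hj hE => ?_⟩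
      have := lt_length_of_getElem? hE
      simp at this
      omega

theorem isCompleted_snoc {o : OpRecord n Op Res} :
    IsCompleted (E ++ [e]) o ↔ IsCompleted E o ∨
      (Unanswered E o.proc o.pos o.op ∧ e = .res o.proc o.res) := by
  constructor
  · rintro ⟨h1, m, hm⟩
    rcases respondsAt_snoc.1 hm with hm | ⟨rfl, i, op, hu, rfl⟩
    · obtain ⟨i, op, h2, -⟩ := id hm
      have h3 := (getElem?_snoc_eq_some E e _ _).2 (Or.inl h2)
      rw [h1] at h3
      cases h3
      exact Or.inl ⟨h2, m, hm⟩
    · have h3 := (getElem?_snoc_eq_some E (.res i o.res) _ _).2 (Or.inl hu.1)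
      rw [h1] at h3
      cases h3
      exact Or.inr ⟨hu, rfl⟩
  · rintro (⟨h1, m, hm⟩ | ⟨h1, h2⟩)
    · exact ⟨(getElem?_snoc_eq_some _ _ _ _).2 (Or.inl h1), m, respondsAt_snoc.2 (Or.inl hm)⟩
    · exact ⟨(getElem?_snoc_eq_some _ _ _ _).2 (Or.inl h1.1), E.length,
        respondsAt_snoc.2 (Or.inr ⟨rfl, _, _, h1, h2⟩)⟩

/-- Precedence concerns a response located before the later invocation, so further events cannot
alter it. This is why a linearization never needs to be reordered as the execution grows. -/
theorem precedes_snoc {k k' : ℕ} (hk' : k' < E.length) :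
    Precedes (E ++ [e]) k k' ↔ Precedes E k k' := by
  have h : (E ++ [e])[k']? = E[k']? := List.getElem?_append_left hk'
  simp only [Precedes, h]
  refine and_congr_right fun _ => exists_congr fun m => exists_congr fun v => ?_
  rw [respondsAt_snoc]
  refine and_congr_left fun hm => or_iff_left ?_
  rintro ⟨rfl, -⟩
  omega

theorem IsSequential.of_snoc (h : IsSequential (E ++ [e])) : IsSequential E := by
  intro k k' i i' op op' h1 h2 hlt
  exact (precedes_snoc (lt_length_of_getElem? h2)).1 (h k k' i i' op op'
    ((getElem?_snoc_eq_some _ _ _ _).2 (Or.inl h1)) ((getElem?_snoc_eq_some _ _ _ _).2 (Or.inl h2))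
    hlt)

theorem IsSequential.not_unanswered_of_snoc_inv {i j : Fin n} {op op' : Op} {k : ℕ}
    (h : IsSequential (E ++ [.inv i op])) : ¬ Unanswered E j k op' := by
  intro hu
  have hk := lt_length_of_getElem? hu.1
  obtain ⟨-, m, v, hm, hlt⟩ := h k E.length j i op' op
    ((getElem?_snoc_eq_some _ _ _ _).2 (Or.inl hu.1))
    ((getElem?_snoc_eq_some _ _ _ _).2 (Or.inr ⟨rfl, rfl⟩)) hk
  rcases respondsAt_snoc.1 hm with hm | ⟨rfl, -⟩
  · exact hm.not_unanswered hu
  · omega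

theorem mem_stepsOf_snoc {k m : ℕ} : m ∈ stepsOf (E ++ [e]) k ↔ m ∈ stepsOf E k ∨
    (m = E.length ∧ ∃ i op a, Unanswered E i k op ∧ e = .step i a) := by
  constructor
  · rintro ⟨i, op, a, h1, h2, h3, h4⟩
    rw [getElem?_snoc_eq_some] at h1 h3
    have h5 : E[k]? = some (.inv i op) := by
      rcases h1 with h1 | ⟨rfl, -⟩
      · exact h1
      · rcases h3 with h3 | ⟨rfl, -⟩
        · have := lt_length_of_getElem? h3; omega
        · omega
    rcases h3 with h3 | ⟨rfl, rfl⟩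
    · exact Or.inl ⟨i, op, a, h5, h2, h3, fun j w hj hm hE =>
        h4 j w hj hm ((getElem?_snoc_eq_some _ _ _ _).2 (Or.inl hE))⟩
    · exact Or.inr ⟨rfl, i, op, a, ⟨h5, fun j w hj hE => h4 j w hj (lt_length_of_getElem? hE)
        ((getElem?_snoc_eq_some _ _ _ _).2 (Or.inl hE))⟩, rfl⟩
  · rintro (⟨i, op, a, h1, h2, h3, h4⟩ | ⟨rfl, i, op, a, ⟨h1, h2⟩, rfl⟩)
    · refine ⟨i, op, a, (getElem?_snoc_eq_some _ _ _ _).2 (Or.inl h1), h2,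
        (getElem?_snoc_eq_some _ _ _ _).2 (Or.inl h3), fun j w hj hm hE => ?_⟩
      rcases (getElem?_snoc_eq_some _ _ _ _).1 hE with hE | ⟨rfl, -⟩
      · exact h4 j w hj hm hE
      · have := lt_length_of_getElem? h3; omega
    · refine ⟨i, op, a, (getElem?_snoc_eq_some _ _ _ _).2 (Or.inl h1), lt_length_of_getElem? h1,
        (getElem?_snoc_eq_some _ _ _ _).2 (Or.inr ⟨rfl, rfl⟩), fun j w hj hm hE => ?_⟩
      rcases (getElem?_snoc_eq_some _ _ _ _).1 hE with hE | ⟨rfl, -⟩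
      · exact h2 j w hj hE
      · omega

end Unanswered

/-! ### Linearization by simulation -/

/-- How far the current operation of a process has come: there is none, it is not linearized yet,
or it is linearized with a response. -/
inductive OpStatus (Op Res : Type) : Type
  | idle
  | todo (op : Op)
  | done (op : Op) (v : Res)

namespace SeqSpec

variable {n : ℕ} {Op Res : Type}

/-- `T.Path q S q'`: the sequence `S` can lead from state `q` to state `q'`. -/
def Path (T : SeqSpec n Op Res) : T.Q → List (OpRecord n Op Res) → T.Q → Prop
  | q, [], q' => q = q'
  | q, o :: S, q' => ∃ q₁, T.δ q o.proc o.op o.res q₁ ∧ T.Path q₁ S q'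

theorem Path.accepts {T : SeqSpec n Op Res} {q q' : T.Q} {S : List (OpRecord n Op Res)}
    (h : T.Path q S q') : T.Accepts q S := by
  induction S generalizing q with
  | nil => trivial
  | cons o S ih =>
    obtain ⟨q₁, h1, h2⟩ := h
    exact ⟨q₁, h1, ih h2⟩

theorem Path.snoc {T : SeqSpec n Op Res} {q q' q'' : T.Q} {S : List (OpRecord n Op Res)}
    {o : OpRecord n Op Res} (h : T.Path q S q') (ho : T.δ q' o.proc o.op o.res q'') :
    T.Path q (S ++ [o]) q'' := by
  induction S generalizing q with
  | nil => cases h; exact ⟨q'', ho, rfl⟩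
  | cons o' S ih =>
    obtain ⟨q₁, h1, h2⟩ := h
    exact ⟨q₁, h1, ih h2⟩

theorem Accepts.of_append {T : SeqSpec n Op Res} {q : T.Q} {S S' : List (OpRecord n Op Res)}
    (h : T.Accepts q (S ++ S')) : T.Accepts q S := by
  induction S generalizing q with
  | nil => trivial
  | cons o S ih =>
    obtain ⟨q₁, h1, h2⟩ := h
    exact ⟨q₁, h1, ih h2⟩

end SeqSpec

section Simulation

variable {Loc : Type} {n : ℕ} {Val : Loc → Type} {Op Res : Type}

/-- `st` describes the current operation of process `i` after the events `E`, of which `S` is the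
linearization. -/
def StatusOf (E : List (Event n Val Op Res)) (S : List (OpRecord n Op Res)) (i : Fin n) :
    OpStatus Op Res → Prop
  | .idle => ∀ k op, ¬ Unanswered E i k op
  | .todo op => ∃ k, Unanswered E i k op ∧ (∀ k' op', Unanswered E i k' op' → k' = k) ∧
      ∀ o ∈ S, o.pos ≠ k
  | .done op v => ∃ k, Unanswered E i k op ∧ (∀ k' op', Unanswered E i k' op' → k' = k) ∧
      ⟨k, i, op, v⟩ ∈ S

/-- `S` is a linearization of `E` that leads to the state `q` and agrees with the statuses `st`. -/
structure Tracks (T : SeqSpec n Op Res) (E : List (Event n Val Op Res)) (q : T.Q)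
    (st : Fin n → OpStatus Op Res) (S : List (OpRecord n Op Res)) : Prop where
  path : T.Path T.init S q
  nodup : (S.map OpRecord.pos).Nodup
  mem : ∀ o ∈ S, IsCompleted E o ∨ Unanswered E o.proc o.pos o.op
  completed : ∀ o, IsCompleted E o → o ∈ S
  order : S.Pairwise fun o o' => ¬ Precedes E o'.pos o.pos
  status : ∀ i, StatusOf E S i (st i)

variable {T : SeqSpec n Op Res} {E : List (Event n Val Op Res)} {q : T.Q}
  {st : Fin n → OpStatus Op Res} {S : List (OpRecord n Op Res)}

theorem Tracks.isLinearization (h : Tracks T E q st S) : IsLinearization T E S :=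
  ⟨h.path.accepts, h.nodup, fun o ho => (h.mem o ho).imp_right (isPending_iff o).2, h.completed,
    h.order⟩

theorem Tracks.getElem?_pos (h : Tracks T E q st S) {o : OpRecord n Op Res} (ho : o ∈ S) :
    E[o.pos]? = some (.inv o.proc o.op) :=
  (h.mem o ho).elim (fun h => h.1) fun h => h.1

theorem Tracks.pairwise_snoc (h : Tracks T E q st S) (e : Event n Val Op Res) :
    S.Pairwise fun o o' => ¬ Precedes (E ++ [e]) o'.pos o.pos :=
  h.order.imp_of_mem fun ho _ hp hp' =>
    hp ((precedes_snoc (lt_length_of_getElem? (h.getElem?_pos ho))).1 hp')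

theorem tracks_nil (T : SeqSpec n Op Res) :
    Tracks T ([] : List (Event n Val Op Res)) T.init (fun _ => .idle) [] where
  path := rfl
  nodup := by simp
  mem := by simp
  completed := fun o ho => by simp [IsCompleted] at ho
  order := List.Pairwise.nil
  status := fun i k op h => by simp [Unanswered] at h

theorem Tracks.inv (h : Tracks T E q st S) {i : Fin n} (op : Op) (hi : st i = .idle) :
    Tracks T (E ++ [.inv i op]) q (Function.update st i (.todo op)) S where
  path := h.path
  nodup := h.nodup
  mem := fun o ho => (h.mem o ho).imp (fun hc => isCompleted_snoc.2 (Or.inl hc))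
    fun hu => unanswered_snoc.2 (Or.inl ⟨hu, by simp⟩)
  completed := fun o ho => h.completed o (by simpa [isCompleted_snoc] using ho)
  order := h.pairwise_snoc _
  status := by
    intro j
    have hj := h.status j
    by_cases hji : j = i
    · subst hji
      rw [hi] at hj
      rw [Function.update_self]
      refine ⟨E.length, unanswered_snoc.2 (Or.inr ⟨rfl, rfl⟩), fun k' op' hu => ?_, fun o ho =>
        (lt_length_of_getElem? (h.getElem?_pos ho)).ne⟩
      rcases unanswered_snoc.1 hu with ⟨hu, -⟩ | ⟨hk, -⟩
      · exact (hj _ _ hu).elim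
      · exact hk
    · rw [Function.update_of_ne hji]
      have key : ∀ k op', Unanswered (E ++ [.inv i op]) j k op' ↔ Unanswered E j k op' := by
        intro k op'
        rw [unanswered_snoc]
        simp [Ne.symm hji]
      cases hst : st j <;> rw [hst] at hj <;> simpa only [StatusOf, key] using hj

theorem Tracks.step (h : Tracks T E q st S) (i : Fin n) (a : Instr Val) :
    Tracks T (E ++ [.step i a]) q st S where
  path := h.path
  nodup := h.nodup
  mem := fun o ho => (h.mem o ho).imp (fun hc => isCompleted_snoc.2 (Or.inl hc))
    fun hu => unanswered_snoc.2 (Or.inl ⟨hu, by simp⟩)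
  completed := fun o ho => h.completed o (by simpa [isCompleted_snoc] using ho)
  order := h.pairwise_snoc _
  status := by
    intro j
    have hj := h.status j
    have key : ∀ k op', Unanswered (E ++ [.step i a]) j k op' ↔ Unanswered E j k op' := by
      intro k op'
      rw [unanswered_snoc]
      simp
    cases hst : st j <;> rw [hst] at hj <;> simpa only [StatusOf, key] using hj

/-- The appended operation is unanswered, hence precedes nothing, and the end of the list is a legal
place for it. Its response is chosen here, before the process returns it. -/
theorem Tracks.linearize (h : Tracks T E q st S) {i : Fin n} {op : Op} {v : Res} {q' : T.Q}
    (hi : st i = .todo op) (hq : T.δ q i op v q') :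
    ∃ S', Tracks T E q' (Function.update st i (.done op v)) S' := by
  have hst := h.status i
  rw [hi] at hst
  obtain ⟨k, hk, huniq, hS⟩ := hst
  refine ⟨S ++ [⟨k, i, op, v⟩], h.path.snoc hq, ?_, ?_, ?_, ?_, ?_⟩
  · rw [List.map_append, List.nodup_append]
    refine ⟨h.nodup, by simp, ?_⟩
    simpa using hS
  · intro o ho
    rcases List.mem_append.1 ho with ho | ho
    · exact h.mem o ho
    · rw [List.mem_singleton] at ho
      subst ho
      exact Or.inr hk
  · exact fun o ho => List.mem_append_left _ (h.completed o ho)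
  · rw [List.pairwise_append]
    refine ⟨h.order, List.pairwise_singleton _ _, fun o _ o' ho' => ?_⟩
    rw [List.mem_singleton] at ho'
    subst ho'
    rintro ⟨-, m, w, hm, -⟩
    exact hm.not_unanswered hk
  · intro j
    by_cases hji : j = i
    · subst hji
      rw [Function.update_self]
      exact ⟨k, hk, huniq, by simp⟩
    · rw [Function.update_of_ne hji]
      have hj := h.status j
      cases hst : st j <;> rw [hst] at hj
      · exact hj
      · obtain ⟨k', hk', hu', hS'⟩ := hj
        refine ⟨k', hk', hu', fun o ho => ?_⟩
        rcases List.mem_append.1 ho with ho | ho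
        · exact hS' o ho
        · rw [List.mem_singleton] at ho
          subst ho
          rintro rfl
          have h1 := hk.1
          rw [hk'.1] at h1
          cases h1
          exact hji rfl
      · obtain ⟨k', hk', hu', hS'⟩ := hj
        exact ⟨k', hk', hu', List.mem_append_left _ hS'⟩

/-- A process has only one unanswered invocation, and positions in `S` are distinct. So the record
that becomes completed is the one already listed, with the response fixed at its linearization
point. -/
theorem Tracks.res (h : Tracks T E q st S) {i : Fin n} {op : Op} {v : Res}
    (hi : st i = .done op v) :
    Tracks T (E ++ [.res i v]) q (Function.update st i .idle) S := by
  have hst := h.status i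
  rw [hi] at hst
  obtain ⟨k, hk, huniq, hS⟩ := hst
  refine ⟨h.path, h.nodup, fun o ho => ?_, fun o ho => ?_, h.pairwise_snoc _, fun j => ?_⟩
  · rcases h.mem o ho with hc | hu
    · exact Or.inl (isCompleted_snoc.2 (Or.inl hc))
    · by_cases hoi : o.proc = i
      · have hpos : o.pos = k := huniq _ _ (hoi ▸ hu)
        have : o = ⟨k, i, op, v⟩ := List.inj_on_of_nodup_map h.nodup ho hS hpos
        subst this
        exact Or.inl (isCompleted_snoc.2 (Or.inr ⟨hu, rfl⟩))
      · refine Or.inr (unanswered_snoc.2 (Or.inl ⟨hu, fun w hw => ?_⟩))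
        cases hw
        exact hoi rfl
  · rcases isCompleted_snoc.1 ho with ho | ⟨hu, he⟩
    · exact h.completed o ho
    · obtain ⟨pos, proc, op', w⟩ := o
      cases he
      obtain rfl : pos = k := huniq _ _ hu
      have h1 := hu.1
      rw [hk.1] at h1
      cases h1
      exact hS
  · by_cases hji : j = i
    · subst hji
      rw [Function.update_self]
      intro k' op' hu
      rcases unanswered_snoc.1 hu with ⟨-, hne⟩ | ⟨-, he⟩
      · exact hne v rfl
      · cases he
    · rw [Function.update_of_ne hji]
      have hj := h.status j
      have key : ∀ k op', Unanswered (E ++ [.res i v]) j k op' ↔ Unanswered E j k op' := by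
        intro k op'
        rw [unanswered_snoc]
        simp [Ne.symm hji]
      cases hst : st j <;> rw [hst] at hj <;> simpa only [StatusOf, key] using hj

namespace Algorithm

variable [DecidableEq Loc]

/-- A forward simulation from `A` to the specification `T` with fixed linearization points.  If
`seq` holds, only invocations in configurations without a running operation are considered. -/
structure Simulation (A : Algorithm n Val Op Res) (T : SeqSpec n Op Res) (seq : Prop)
    (Inv : A.Config → T.Q → (Fin n → OpStatus Op Res) → Prop) : Prop where
  init : ∀ C, A.Initial C → Inv C T.init fun _ => .idle
  inv : ∀ C q st i p op, Inv C q st → (seq → ∀ j, st j = .idle) → C.proc i = .idle p →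
    A.mayInvoke i op → st i = .idle ∧
      Inv ⟨C.mem, Function.update C.proc i (.busy (A.start i op p))⟩ q
        (Function.update st i (.todo op))
  step : ∀ C q st i c a, Inv C q st → C.proc i = .busy c → a ∈ A.instr c →
    Inv ⟨a.apply C.mem, Function.update C.proc i (.busy (A.next c a (a.resp C.mem)))⟩ q st ∨
    ∃ op v q', st i = .todo op ∧ T.δ q i op v q' ∧
      Inv ⟨a.apply C.mem, Function.update C.proc i (.busy (A.next c a (a.resp C.mem)))⟩ q'
        (Function.update st i (.done op v))
  res : ∀ C q st i c v p, Inv C q st → C.proc i = .busy c → A.out c = some (v, p) →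
    ∃ op, st i = .done op v ∧
      Inv ⟨C.mem, Function.update C.proc i (.idle p)⟩ q (Function.update st i .idle)

variable {A : Algorithm n Val Op Res} {seq : Prop}
  {Inv : A.Config → T.Q → (Fin n → OpStatus Op Res) → Prop}

theorem Simulation.exists_tracks (h : A.Simulation T seq Inv) {C C' : A.Config}
    (hC : A.Initial C) (hE : A.Run C E C') (hseq : seq → IsSequential E) :
    ∃ q st S, Inv C' q st ∧ Tracks T E q st S := by
  induction hE with
  | nil => exact ⟨_, _, _, h.init C hC, tracks_nil T⟩
  | snoc hE he ih =>
    obtain ⟨q, st, S, hI, hT⟩ := ih fun hs => (hseq hs).of_snoc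
    cases he with
    | inv hi hop =>
      -- A status other than `idle` provides an unanswered invocation, which cannot be followed by a
      -- new invocation in a sequential execution.
      obtain ⟨h1, h2⟩ := h.inv _ q st _ _ _ hI (fun hs j => by
        have hj := hT.status j
        cases hst : st j with
        | idle => rfl
        | todo op =>
          rw [hst] at hj
          obtain ⟨k, hk, -⟩ := hj
          exact ((hseq hs).not_unanswered_of_snoc_inv hk).elim
        | done op v =>
          rw [hst] at hj
          obtain ⟨k, hk, -⟩ := hj
          exact ((hseq hs).not_unanswered_of_snoc_inv hk).elim) hi hop
      exact ⟨_, _, _, h2, hT.inv _ h1⟩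
    | step hi ha =>
      rcases h.step _ q st _ _ _ hI hi ha with h1 | ⟨op, v, q', h1, h2, h3⟩
      · exact ⟨_, _, _, h1, hT.step _ _⟩
      · obtain ⟨S', hS'⟩ := (hT.step _ _).linearize h1 h2
        exact ⟨_, _, _, h3, hS'⟩
    | res hi hv =>
      obtain ⟨op, h1, h2⟩ := h.res _ q st _ _ _ _ hI hi hv
      exact ⟨_, _, _, h2, hT.res h1⟩

theorem Simulation.linearizable (h : A.Simulation T False Inv) : A.Linearizable T := by
  rintro E ⟨C, C', hC, hE⟩
  obtain ⟨q, st, S, -, hT⟩ := h.exists_tracks hC hE False.elim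
  exact ⟨S, hT.isLinearization⟩

end Algorithm

/-- In a sequential execution, a linearization lists the operations in their order, and only its
last operation can be pending. -/
theorem IsLinearization.exists_completed (h : IsLinearization T E S) (hE : IsSequential E) :
    ∃ S' : List (OpRecord n Op Res), S'.Pairwise (fun o o' => o.pos < o'.pos) ∧
      (∀ o, o ∈ S' ↔ IsCompleted E o) ∧ T.IsSeqExecution S' := by
  obtain ⟨hacc, hnd, hmem, hcompl, hord⟩ := h
  have hinv : ∀ o ∈ S, E[o.pos]? = some (.inv o.proc o.op) := fun o ho =>
    (hmem o ho).elim (fun h => h.1) fun h => h.1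
  -- Without concurrency the real-time order is total on invocations, so respecting it means being
  -- sorted by position.
  have hsorted : S.Pairwise fun o o' => o.pos < o'.pos := by
    have hne : S.Pairwise fun o o' => o.pos ≠ o'.pos := List.pairwise_map.1 hnd
    refine (hne.and hord).imp_of_mem fun {o o'} ho ho' hh => ?_
    by_contra hlt
    exact hh.2 (hE _ _ _ _ _ _ (hinv o' ho') (hinv o ho)
      (lt_of_le_of_ne (not_lt.1 hlt) hh.1.symm))
  have hcp : ∀ o, IsCompleted E o → ¬ IsPending E o := fun o hc hp => by
    obtain ⟨m, hm⟩ := hc.2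
    exact hp.2 m _ hm
  rcases List.eq_nil_or_concat' S with rfl | ⟨S', o, rfl⟩
  · exact ⟨[], List.Pairwise.nil, fun o => ⟨fun ho => by simp at ho, hcompl o⟩, trivial⟩
  · have hS' : ∀ o' ∈ S', IsCompleted E o' := by
      intro o' ho'
      refine (hmem o' (by simp [ho'])).resolve_right fun hp => ?_
      have hlt : o'.pos < o.pos := (List.pairwise_append.1 hsorted).2.2 o' ho' o (by simp)
      obtain ⟨-, m, v, hm, -⟩ := hE _ _ _ _ _ _ (hinv o' (by simp [ho'])) (hinv o (by simp)) hlt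
      exact hp.2 m v hm
    rcases hmem o (by simp) with hc | hp
    · refine ⟨_, hsorted, fun o' => ⟨fun ho' => ?_, hcompl o'⟩, hacc⟩
      rcases List.mem_append.1 ho' with ho' | ho'
      · exact hS' o' ho'
      · rw [List.mem_singleton] at ho'
        exact ho' ▸ hc
    -- A pending last operation is removed; a prefix of a sequential execution is again one.
    · refine ⟨S', (List.pairwise_append.1 hsorted).1, fun o' => ⟨hS' o', fun hc => ?_⟩,
        SeqSpec.Accepts.of_append hacc⟩
      rcases List.mem_append.1 (hcompl o' hc) with ho' | ho'
      · exact ho'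
      · rw [List.mem_singleton] at ho'
        exact (hcp o' hc (ho' ▸ hp)).elim

theorem Algorithm.Simulation.sequentiallyExact [DecidableEq Loc] {A : Algorithm n Val Op Res}
    {Inv : A.Config → T.Q → (Fin n → OpStatus Op Res) → Prop} (h : A.Simulation T True Inv) :
    A.SequentiallyExact T := by
  rintro E ⟨C, C', hC, hE⟩ hseq
  obtain ⟨q, st, S, -, hT⟩ := h.exists_tracks hC hE fun _ => hseq
  exact hT.isLinearization.exists_completed hseq

end Simulation

/-! ### Bounds on the number of steps -/

namespace Algorithm

variable {Loc : Type} {n : ℕ} {Val : Loc → Type} {Op Res : Type} [DecidableEq Loc]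
  {A : Algorithm n Val Op Res} {μ : A.Ctl → ℕ}

/-- An operation that never responds keeps its process busy forever. Events of other processes leave
its control state alone and its own events lower `μ`, so it can have only finitely many of them. -/
theorem waitFree_of_measure (hμ : ∀ c, ∀ a ∈ A.instr c, ∀ r, μ (A.next c a r) < μ c) :
    A.WaitFree := by
  rintro e ⟨C, -, hC⟩ i hinf k op hk
  by_contra hno
  push Not at hno
  have hbusy : ∀ m, ∃ c, (C (k + 1 + m)).proc i = .busy c := by
    intro m
    induction m with
    | zero =>
      have h := hC k
      rw [hk] at h
      generalize hD : C (k + 1) = D at h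
      cases h
      simp
    | succ m ih =>
      obtain ⟨c, hc⟩ := ih
      have h := hC (k + 1 + m)
      have hne := hno (k + 1 + m) (by omega)
      rw [← add_assoc]
      generalize C (k + 1 + m + 1) = D at h
      generalize C (k + 1 + m) = D₀ at h hc
      generalize e (k + 1 + m) = ev at h hne
      cases h with
      | @inv j p op hj hop =>
        by_cases hij : i = j
        · subst hij; simp
        · simp [Function.update_of_ne hij, hc]
      | @step j c' a hj ha =>
        by_cases hij : i = j
        · subst hij; simp
        · simp [Function.update_of_ne hij, hc]
      | @res j c' v p hj hv =>
        by_cases hij : i = j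
        · subst hij; exact (hne v rfl).elim
        · simp [Function.update_of_ne hij, hc]
  choose c hc using hbusy
  have hstep : ∀ m, μ (c (m + 1)) ≤ μ (c m) ∧
      ((e (k + 1 + m)).proc = i → μ (c (m + 1)) < μ (c m)) := by
    intro m
    have h := hC (k + 1 + m)
    have hne := hno (k + 1 + m) (by omega)
    have h0 := hc m
    have h1 := hc (m + 1)
    rw [← add_assoc] at h1
    generalize C (k + 1 + m + 1) = D at h h1
    generalize C (k + 1 + m) = D₀ at h h0
    generalize e (k + 1 + m) = ev at h hne
    cases h with
    | @inv j p op hj hop =>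
      by_cases hij : i = j
      · subst hij; rw [h0] at hj; cases hj
      · simp only [Function.update_of_ne hij, h0, Local.busy.injEq] at h1
        exact ⟨h1 ▸ le_rfl, fun h => (hij h.symm).elim⟩
    | @step j c' a hj ha =>
      by_cases hij : i = j
      · subst hij
        rw [h0] at hj
        cases hj
        simp only [Function.update_self, Local.busy.injEq] at h1
        have := hμ _ a ha (a.resp D₀.mem)
        rw [h1] at this
        exact ⟨this.le, fun _ => this⟩
      · simp only [Function.update_of_ne hij, h0, Local.busy.injEq] at h1
        exact ⟨h1 ▸ le_rfl, fun h => (hij h.symm).elim⟩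
    | @res j c' v p hj hv =>
      by_cases hij : i = j
      · subst hij; exact (hne v rfl).elim
      · simp only [Function.update_of_ne hij, h0, Local.busy.injEq] at h1
        exact ⟨h1 ▸ le_rfl, fun h => (hij h.symm).elim⟩
  have hanti : Antitone fun m => μ (c m) := antitone_nat_of_succ_le fun m => (hstep m).1
  -- At the time `N` the measure is minimal, but process `i` still has an event after `N`, and that
  -- event lowers it further.
  have hN := Function.argmin_le fun m => μ (c m)
  set N := Function.argmin fun m => μ (c m)
  obtain ⟨m, hm, hlt⟩ := hinf.exists_gt (k + 1 + N)
  have h1 := (hstep (m - (k + 1))).2 (by rwa [Nat.add_sub_cancel' (by omega)])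
  exact (hN (m - (k + 1) + 1)).not_gt (h1.trans_le (hanti (by omega : N ≤ m - (k + 1))))

/-- As long as an operation is unanswered, the steps it has executed plus the remaining measure stay
at most `b`. Once it has responded its set of steps is frozen. -/
theorem stepComplexityLE_of_measure {b : ℕ} (hstart : ∀ i op p, μ (A.start i op p) ≤ b)
    (hμ : ∀ c, ∀ a ∈ A.instr c, ∀ r, μ (A.next c a r) < μ c) : A.StepComplexityLE b := by
  have key : ∀ (C C' : A.Config) (E : List (Event n Val Op Res)), A.Initial C → A.Run C E C' →
      ∀ k, (stepsOf E k).encard ≤ b ∧ ∀ i op, Unanswered E i k op →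
        ∃ c, C'.proc i = .busy c ∧ (stepsOf E k).encard + μ c ≤ b := by
    intro C C' E hC hE
    induction hE with
    | nil => intro k; simp [stepsOf, Unanswered]
    | @snoc C' C'' E e hE he ih =>
      intro k
      obtain ⟨ih1, ih2⟩ := ih k
      cases he with
      | @inv i p op hi hop =>
        have hs : stepsOf (E ++ [.inv i op]) k = stepsOf E k := by
          ext m; simp [mem_stepsOf_snoc]
        rw [hs]
        refine ⟨ih1, fun j op' hu => ?_⟩
        rcases unanswered_snoc.1 hu with ⟨hu, -⟩ | ⟨rfl, he⟩
        · obtain ⟨c, hc, hle⟩ := ih2 j op' hu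
          have hji : j ≠ i := by
            rintro rfl
            rw [hi] at hc
            cases hc
          exact ⟨c, by simp [Function.update_of_ne hji, hc], hle⟩
        · cases he
          refine ⟨_, Function.update_self .., ?_⟩
          have h0 : stepsOf E E.length = ∅ := by
            ext m
            simp [stepsOf]
          rw [h0]
          simpa using hstart i op p
      | @step i c a hi ha =>
        by_cases hex : ∃ op, Unanswered E i k op
        · obtain ⟨op, hu⟩ := hex
          obtain ⟨c', hc', hle⟩ := ih2 i op hu
          rw [hi] at hc'
          cases hc'
          have hs : stepsOf (E ++ [.step i a]) k ⊆ insert E.length (stepsOf E k) := by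
            intro m hm
            rcases mem_stepsOf_snoc.1 hm with hm | ⟨rfl, -⟩
            · exact Or.inr hm
            · exact Or.inl rfl
          have hle' : (stepsOf (E ++ [.step i a]) k).encard ≤ (stepsOf E k).encard + 1 :=
            (Set.encard_le_encard hs).trans (Set.encard_insert_le _ _)
          have hlt := hμ c a ha (a.resp C'.mem)
          have hlt' : (μ (A.next c a (a.resp C'.mem)) : ℕ∞) + 1 ≤ μ c := by exact_mod_cast hlt
          have hfin : (stepsOf (E ++ [.step i a]) k).encard +
              μ (A.next c a (a.resp C'.mem)) ≤ b := by
            calc _ ≤ (stepsOf E k).encard + 1 + μ (A.next c a (a.resp C'.mem)) := by gcongr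
              _ = (stepsOf E k).encard + (μ (A.next c a (a.resp C'.mem)) + 1) := by
                rw [add_assoc, add_comm (1 : ℕ∞)]
              _ ≤ (stepsOf E k).encard + μ c := by gcongr
              _ ≤ b := hle
          refine ⟨le_self_add.trans hfin, fun j op' hu' => ?_⟩
          have hji : j = i := by
            have h1 : Unanswered E j k op' := by simpa [unanswered_snoc] using hu'
            have h2 := h1.1
            rw [hu.1] at h2
            cases h2
            rfl
          subst hji
          exact ⟨_, Function.update_self .., hfin⟩
        · have hs : stepsOf (E ++ [.step i a]) k = stepsOf E k := by
            ext m
            rw [mem_stepsOf_snoc]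
            refine or_iff_left ?_
            rintro ⟨-, i', op, a', hu, he⟩
            cases he
            exact hex ⟨op, hu⟩
          rw [hs]
          refine ⟨ih1, fun j op' hu => ?_⟩
          replace hu : Unanswered E j k op' := by simpa [unanswered_snoc] using hu
          have hji : j ≠ i := by
            rintro rfl
            exact hex ⟨op', hu⟩
          obtain ⟨c', hc', hle⟩ := ih2 j op' hu
          exact ⟨c', by simp [Function.update_of_ne hji, hc'], hle⟩
      | @res i c v p hi hv =>
        have hs : stepsOf (E ++ [.res i v]) k = stepsOf E k := by
          ext m; simp [mem_stepsOf_snoc]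
        rw [hs]
        refine ⟨ih1, fun j op' hu => ?_⟩
        rcases unanswered_snoc.1 hu with ⟨hu, hne⟩ | ⟨-, he⟩
        · have hji : j ≠ i := by
            rintro rfl
            exact hne v rfl
          obtain ⟨c', hc', hle⟩ := ih2 j op' hu
          exact ⟨c', by simp [Function.update_of_ne hji, hc'], hle⟩
        · cases he
  rintro E ⟨C, C', hC, hE⟩ k
  exact (key C C' E hC hE k).1

end Algorithm


/-! ### Steps of WS-WMULT -/

/-- Contents of the shared memory. -/
abbrev Mem : Type := (l : WSLoc) → WSVal l

/-- Steps of a call of `RMaxWrite`. -/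
inductive RMaxWrite.Step (m : Mem) : RMaxWrite → Mem → RMaxWrite → Prop
  | readLow {x r : ℕ} (h : max r (m .R) < x) : Step m (.read x r) m (.write x)
  | readHigh {x r : ℕ} (h : x ≤ max r (m .R)) : Step m (.read x r) m (.ret (max r (m .R)))
  | write {x : ℕ} : Step m (.write x) (Function.update m .R x) (.ret x)

/-- Steps inside an operation. -/
inductive WSCtl.Step (m : Mem) : WSCtl → Mem → WSCtl → Prop
  | putTask {p : WSPers} {x : ℕ+} {dB : Bool} :
      Step m (.put p x false dB) (Function.update m (.tasks p.tail) (some x)) (.put p x true dB)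
  | putBot {p : WSPers} {x : ℕ+} {dT : Bool} :
      Step m (.put p x dT false) (Function.update m (.tasks (p.tail + 2)) none) (.put p x dT true)
  | takeHead {p : WSPers} (h : max p.r (m .R) ≤ p.tail) :
      Step m (.takeHead p) m (.takeBody { p with r := max p.r (m .R) } (max p.r (m .R)) none
        (.read (max p.r (m .R) + 1) (max p.r (m .R))))
  | takeEmpty {p : WSPers} (h : p.tail < max p.r (m .R)) :
      Step m (.takeHead p) m (.retEmpty { p with r := max p.r (m .R) })
  | takeTask {p : WSPers} {head : ℕ} {w : RMaxWrite} :
      Step m (.takeBody p head none w) m (.takeBody p head (some (m (.tasks head))) w)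
  | takeWrite {p : WSPers} {head : ℕ} {x : Option (Option ℕ+)} {w w' : RMaxWrite} {m' : Mem}
      (h : w.Step m m' w') : Step m (.takeBody p head x w) m' (.takeBody p head x w')
  | stealHead {p : WSPers} :
      Step m (.stealHead p) m (.stealTask { p with r := max p.r (m .R) } (max p.r (m .R)))
  | stealTask {p : WSPers} {head : ℕ} {x : ℕ+} (h : m (.tasks head) = some x) :
      Step m (.stealTask p head) m (.stealWrite p x (.read (head + 1) p.r))
  | stealEmpty {p : WSPers} {head : ℕ} (h : m (.tasks head) = none) :
      Step m (.stealTask p head) m (.retEmpty p)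
  | stealWrite {p : WSPers} {x : ℕ+} {w w' : RMaxWrite} {m' : Mem} (h : w.Step m m' w') :
      Step m (.stealWrite p x w) m' (.stealWrite p x w')

theorem RMaxWrite.step_onRead (m : Mem) (x r : ℕ) :
    (RMaxWrite.read x r).Step m m ((RMaxWrite.read x r).onRead (m .R)) := by
  by_cases h : max r (m .R) < x
  · simpa only [onRead, if_pos h] using Step.readLow h
  · simpa only [onRead, if_neg h] using Step.readHigh (not_lt.1 h)

/-- Replaces the dependently typed pair of `instr` and `next` by an inductive relation on memory and
control state, so that both simulations can argue by cases on a step. The default case of `next`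
does not occur for admitted instructions. -/
theorem WSCtl.step_of_mem_instr (m : Mem) {c : WSCtl} {a : Instr WSVal} (ha : a ∈ c.instr) :
    c.Step m (a.apply m) (c.next a (a.resp m)) := by
  rcases c with ⟨p, x, dT, dB⟩ | p | ⟨p, head, x, w⟩ | p | ⟨p, head⟩ | ⟨p, x, w⟩ | p
  · rcases ha with ⟨rfl, rfl⟩ | ⟨rfl, rfl⟩
    · simpa [Instr.apply, next] using Step.putTask
    · simpa [Instr.apply, next] using Step.putBot
  · cases ha
    by_cases h : max p.r (m .R) ≤ p.tail
    · change Step m (takeHead p) m (if max p.r (m .R) ≤ p.tail then _ else _)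
      rw [if_pos h]
      exact .takeHead h
    · change Step m (takeHead p) m (if max p.r (m .R) ≤ p.tail then _ else _)
      rw [if_neg h]
      exact .takeEmpty (not_le.1 h)
  · rcases ha with ⟨rfl, rfl⟩ | ha
    · exact .takeTask
    · rcases w with ⟨y, r⟩ | y | r <;> cases ha
      · exact .takeWrite (RMaxWrite.step_onRead m y r)
      · exact .takeWrite .write
  · cases ha
    exact .stealHead
  · cases ha
    cases h : m (.tasks head) with
    | none => simpa only [next, Instr.apply, Instr.resp, h] using Step.stealEmpty h
    | some x => simpa only [next, Instr.apply, Instr.resp, h] using Step.stealTask h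
  · rcases w with ⟨y, r⟩ | y | r <;> cases ha
    · exact .stealWrite (RMaxWrite.step_onRead m y r)
    · exact .stealWrite .write
  · cases ha

/-! ### Read/Write, fence-freedom, step complexity -/

theorem RMaxWrite.isReadWrite {w : RMaxWrite} {a : Instr WSVal} (ha : a ∈ w.instr) :
    a.IsReadWrite := by
  cases w <;> cases ha <;> trivial

theorem WSCtl.isReadWrite {c : WSCtl} {a : Instr WSVal} (ha : a ∈ c.instr) : a.IsReadWrite := by
  rcases c with ⟨p, x, dT, dB⟩ | p | ⟨p, head, x, w⟩ | p | ⟨p, head⟩ | ⟨p, x, w⟩ | p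
  · rcases ha with ⟨-, rfl⟩ | ⟨-, rfl⟩ <;> trivial
  · cases ha; trivial
  · rcases ha with ⟨-, rfl⟩ | ha
    · trivial
    · exact RMaxWrite.isReadWrite ha
  · cases ha; trivial
  · cases ha; trivial
  · exact RMaxWrite.isReadWrite ha
  · cases ha

/-- The number of steps that a call of `RMaxWrite` still executes, at most. -/
def RMaxWrite.fuel : RMaxWrite → ℕ
  | read _ _ => 2
  | write _ => 1
  | ret _ => 0

/-- The number of steps that an operation still executes, at most. -/
def WSCtl.fuel : WSCtl → ℕ
  | put _ _ dT dB => (if dT then 0 else 1) + (if dB then 0 else 1)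
  | takeHead _ => 4
  | takeBody _ _ x w => (if x = none then 1 else 0) + w.fuel
  | stealHead _ => 4
  | stealTask _ _ => 3
  | stealWrite _ _ w => w.fuel
  | retEmpty _ => 0

theorem RMaxWrite.fuel_onRead_lt (x r v : ℕ) :
    ((RMaxWrite.read x r).onRead v).fuel < (RMaxWrite.read x r).fuel := by
  simp only [onRead]
  split_ifs <;> simp [fuel]

theorem WSCtl.fuel_next_lt {c : WSCtl} {a : Instr WSVal} (ha : a ∈ c.instr) (r : a.Resp) :
    (c.next a r).fuel < c.fuel := by
  rcases c with ⟨p, x, dT, dB⟩ | p | ⟨p, head, x, w⟩ | p | ⟨p, head⟩ | ⟨p, x, w⟩ | p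
  · rcases ha with ⟨rfl, rfl⟩ | ⟨rfl, rfl⟩ <;> simp [next, fuel]
  · cases ha
    simp only [next]
    split_ifs <;> simp [fuel, RMaxWrite.fuel]
  · rcases ha with ⟨rfl, rfl⟩ | ha
    · simp [next, fuel]
    · rcases w with ⟨y, s⟩ | y | s <;> cases ha
      · simpa [next, fuel] using RMaxWrite.fuel_onRead_lt y s r
      · simp [next, fuel, RMaxWrite.onWrite, RMaxWrite.fuel]
  · cases ha
    simp [next, fuel]
  · cases ha
    cases r <;> simp [next, fuel, RMaxWrite.fuel]
  · rcases w with ⟨y, s⟩ | y | s <;> cases ha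
    · simpa [next, fuel] using RMaxWrite.fuel_onRead_lt y s r
    · simp [next, fuel, RMaxWrite.onWrite, RMaxWrite.fuel]
  · cases ha

/-- `Take` and `Steal` need at most one read of `R` for the head, one read of the array, and a read
and a write of `R` in `RMaxWrite`; `Put` needs two writes. -/
theorem WSCtl.fuel_start_le (op : WSOp) (p : WSPers) : (WSCtl.start op p).fuel ≤ 4 := by
  cases op <;> simp [start, fuel]

theorem wsWMult_fullyReadWrite (n : ℕ) : (wsWMult n).FullyReadWrite :=
  fun _ _ _ ha => WSCtl.isReadWrite ha

theorem wsWMult_waitFree (n : ℕ) : (wsWMult n).WaitFree :=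
  Algorithm.waitFree_of_measure (A := wsWMult n) (μ := WSCtl.fuel)
    fun _ _ ha r => WSCtl.fuel_next_lt ha r

theorem wsWMult_stepComplexityLE (n : ℕ) : (wsWMult n).StepComplexityLE 4 :=
  Algorithm.stepComplexityLE_of_measure (A := wsWMult n) (μ := WSCtl.fuel)
    (fun _ op p => WSCtl.fuel_start_le op p) fun _ _ ha r => WSCtl.fuel_next_lt ha r

theorem RMaxWrite.loc_of_mem_instr {w : RMaxWrite} {a : Instr WSVal} (ha : a ∈ w.instr) :
    a.loc = .R := by
  cases w <;> cases ha <;> rfl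

theorem wsWMult_fenceFree (n : ℕ) : (wsWMult n).FenceFree := by
  rintro c - a ha b ⟨hloc, hb⟩
  change a ∈ WSCtl.instr c at ha
  change ∀ r : a.Resp, b ∈ WSCtl.instr (WSCtl.next c a r) at hb
  change b ∈ WSCtl.instr c ∧ ∀ (r : a.Resp) (s : b.Resp), a ∈ WSCtl.instr (WSCtl.next c b s) ∧
    WSCtl.next (WSCtl.next c b s) a r = WSCtl.next (WSCtl.next c a r) b s
  rcases c with ⟨p, x, dT, dB⟩ | p | ⟨p, head, x, w⟩ | p | ⟨p, head⟩ | ⟨p, x, w⟩ | p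
  · rcases ha with ⟨rfl, rfl⟩ | ⟨rfl, rfl⟩
    · have h := hb ()
      simp only [WSCtl.next, if_true] at h
      rcases h with ⟨h, -⟩ | ⟨rfl, rfl⟩
      · cases h
      · simp [WSCtl.next, WSCtl.instr]
    · have h := hb ()
      simp only [WSCtl.next, Nat.add_eq_left, OfNat.ofNat_ne_zero, if_false] at h
      rcases h with ⟨rfl, rfl⟩ | ⟨h, -⟩
      · simp [WSCtl.next, WSCtl.instr]
      · cases h
  · cases ha
    -- An answer above `tail` ends the operation, so no instruction can follow whatever the answer
    -- is.
    have h := hb (p.tail + 1)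
    simp [WSCtl.next, WSCtl.instr] at h
  · rcases ha with ⟨rfl, rfl⟩ | ha
    · have h : b ∈ WSCtl.instr (.takeBody p head (some none) w) := hb none
      rcases h with ⟨h, -⟩ | h
      · cases h
      · refine ⟨Or.inr h, fun r s => ?_⟩
        rcases w with ⟨y, u⟩ | y | u <;> cases h <;>
          exact ⟨Or.inl ⟨rfl, rfl⟩, rfl⟩
    · have hR := RMaxWrite.loc_of_mem_instr ha
      -- All instructions of `RMaxWrite` access `R`, so an instruction on another object must be the
      -- array read.
      have key : x = none ∧ b = .read (.tasks head) := by
        rcases w with ⟨y, u⟩ | y | u <;> cases ha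
        · rcases hb (0 : ℕ) with h | h
          · exact h
          · exact (hloc (RMaxWrite.loc_of_mem_instr h).symm).elim
        · rcases hb () with h | h
          · exact h
          · exact (hloc (RMaxWrite.loc_of_mem_instr h).symm).elim
      obtain ⟨rfl, rfl⟩ := key
      refine ⟨Or.inl ⟨rfl, rfl⟩, fun r s => ⟨Or.inr ha, ?_⟩⟩
      rcases w with ⟨y, u⟩ | y | u <;> cases ha <;> rfl
  · cases ha
    -- Two different answers lead to reads of two different entries: the array read depends on the
    -- head.
    have h1 : b = .read (.tasks (max p.r p.r)) := hb p.r
    have h2 : b = .read (.tasks (max p.r (p.r + 1))) := hb (p.r + 1)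
    rw [h1] at h2
    simp at h2
  · cases ha
    -- After the answer `⊥` no instruction is left.
    exact (hb none).elim
  · have hR := RMaxWrite.loc_of_mem_instr ha
    rcases w with ⟨y, u⟩ | y | u <;> cases ha
    · exact (hloc (RMaxWrite.loc_of_mem_instr (hb (0 : ℕ))).symm).elim
    · exact (hloc (RMaxWrite.loc_of_mem_instr (w := .ret y) (hb ())).symm).elim
  · cases ha


/-! ### The contents of the array -/

section Tasks

variable {n : ℕ}

theorem update_tasks_self (m : Mem) (k : ℕ) (v : Option ℕ+) :
    Function.update m (.tasks k) v (.tasks k) = v :=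
  Function.update_self ..

theorem update_tasks_of_ne (m : Mem) {j k : ℕ} (v : Option ℕ+) (h : k ≠ j) :
    Function.update m (.tasks j) v (.tasks k) = m (.tasks k) :=
  Function.update_of_ne (by simpa using h) ..

/-- What the owner, in the middle of an operation, knows about `tail` and the end of the array, if
`xs` is the list of the tasks that have been written so far. -/
def OwnerCtl (m : Mem) (xs : List ℕ+) : WSCtl → Prop
  | .put p _ false dB => p.tail = xs.length + 1 ∧ m (.tasks (xs.length + 2)) = none ∧
      (dB = true → m (.tasks (xs.length + 3)) = none)
  | .put p _ true dB => p.tail = xs.length ∧ (dB = true → m (.tasks (xs.length + 2)) = none)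
  | .takeHead p => p.tail = xs.length ∧ m (.tasks (xs.length + 2)) = none
  | .takeBody p _ _ _ => p.tail = xs.length ∧ m (.tasks (xs.length + 2)) = none
  -- The owner is never in a control state of `Steal`; the relations `WeakCtl` and `SeqCtl` exclude
  -- it.
  | .stealHead _ => True
  | .stealTask _ _ => True
  | .stealWrite _ _ _ => True
  | .retEmpty p => p.tail = xs.length ∧ m (.tasks (xs.length + 2)) = none

/-- What the owner, between two operations, knows about `tail` and the end of the array. -/
def OwnerIdle (m : Mem) (xs : List ℕ+) (p : WSPers) : Prop :=
  p.tail = xs.length ∧ m (.tasks (xs.length + 2)) = none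

def OwnerLocal (m : Mem) (xs : List ℕ+) : (wsWMult n).Local → Prop
  | .idle p => OwnerIdle m xs p
  | .busy c => OwnerCtl m xs c

/-- `xs` is the list of the tasks that have been written to the array so far. -/
structure TaskInv (C : (wsWMult n).Config) (xs : List ℕ+) : Prop where
  written : ∀ k x, xs[k]? = some x → C.mem (.tasks (k + 1)) = some x
  next : C.mem (.tasks (xs.length + 1)) = none
  owner : ∀ i : Fin n, i.val = 0 → OwnerLocal C.mem xs (C.proc i)

theorem OwnerLocal.congr {m m' : Mem} {xs : List ℕ+} {loc : (wsWMult n).Local}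
    (h : OwnerLocal m xs loc) (hm : ∀ k, m' (.tasks k) = m (.tasks k)) :
    OwnerLocal m' xs loc := by
  rcases loc with p | (⟨p, x, _ | _, dB⟩ | p | ⟨p, head, x, w⟩ | p | ⟨p, head⟩ | ⟨p, x, w⟩ | p) <;>
  simp_all only [OwnerLocal, OwnerIdle, OwnerCtl, implies_true, and_self]

variable {C : (wsWMult n).Config} {xs : List ℕ+} {i : Fin n}

theorem TaskInv.frame (h : TaskInv C xs) {m' : Mem} {loc : (wsWMult n).Local}
    (hm : ∀ k, m' (.tasks k) = C.mem (.tasks k))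
    (ho : i.val = 0 → OwnerLocal C.mem xs loc) :
    TaskInv ⟨m', Function.update C.proc i loc⟩ xs where
  written k x hx := (hm _).trans (h.written k x hx)
  next := (hm _).trans h.next
  owner j hj := by
    by_cases hji : j = i
    · subst hji
      simpa only [Function.update_self] using (ho hj).congr hm
    · simpa only [Function.update_of_ne hji] using (h.owner j hj).congr hm

theorem TaskInv.ownerCtl (h : TaskInv C xs) {c : WSCtl} (hi : C.proc i = .busy c)
    (hi0 : i.val = 0) : OwnerCtl C.mem xs c := by
  have := h.owner i hi0
  rwa [hi] at this

/-- The entry that now follows the last task was already `⊥` before this `Put`, initially or by the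
preceding `Put`. Hence the task may be published before the `⊥` of this `Put` is written. -/
theorem TaskInv.putTask (h : TaskInv C xs) {p : WSPers} {x : ℕ+} {dB : Bool} (hi0 : i.val = 0)
    (hi : C.proc i = .busy (.put p x false dB)) :
    TaskInv ⟨Function.update C.mem (.tasks p.tail) (some x),
      Function.update C.proc i (.busy (.put p x true dB))⟩ (xs ++ [x]) := by
  obtain ⟨h1, h2, h3⟩ := h.ownerCtl hi hi0
  have hl : (xs ++ [x]).length = xs.length + 1 := by simp
  constructor
  · intro k y hy
    rcases (getElem?_snoc_eq_some _ _ _ _).1 hy with hy | ⟨rfl, rfl⟩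
    · have hk := lt_length_of_getElem? hy
      exact (update_tasks_of_ne _ _ (by omega)).trans (h.written k y hy)
    · rw [← h1]
      exact update_tasks_self ..
  · exact (update_tasks_of_ne _ _ (by omega)).trans (by rw [hl]; exact h2)
  · intro j hj
    obtain rfl : j = i := Fin.ext (hj.trans hi0.symm)
    simp only [Function.update_self]
    refine ⟨h1.trans hl.symm, fun hd => ?_⟩
    exact (update_tasks_of_ne _ _ (by omega)).trans (by rw [hl]; exact h3 hd)

/-- Since `tail ≥ |xs|`, the entry `tail + 2` lies beyond all tasks, and writing `⊥` cannot destroy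
the fact that an entry is `⊥`. -/
theorem TaskInv.putBot (h : TaskInv C xs) {p : WSPers} {x : ℕ+} {dT : Bool} (hi0 : i.val = 0)
    (hi : C.proc i = .busy (.put p x dT false)) :
    TaskInv ⟨Function.update C.mem (.tasks (p.tail + 2)) none,
      Function.update C.proc i (.busy (.put p x dT true))⟩ xs := by
  have ho := h.ownerCtl hi hi0
  have htail : xs.length ≤ p.tail := by
    cases dT
    · exact ho.1 ▸ Nat.le_succ _
    · exact ho.1.ge
  have hnone : ∀ k, C.mem (.tasks k) = none →
      Function.update C.mem (.tasks (p.tail + 2)) none (.tasks k) = none := by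
    intro k hk
    by_cases hkt : k = p.tail + 2
    · subst hkt; exact update_tasks_self ..
    · exact (update_tasks_of_ne _ _ hkt).trans hk
  constructor
  · intro k y hy
    have hk := lt_length_of_getElem? hy
    exact (update_tasks_of_ne _ _ (by omega)).trans (h.written k y hy)
  · exact hnone _ h.next
  · intro j hj
    obtain rfl : j = i := Fin.ext (hj.trans hi0.symm)
    simp only [Function.update_self, OwnerLocal]
    cases dT
    · refine ⟨ho.1, hnone _ ho.2.1, fun _ => ?_⟩
      rw [ho.1]
      exact update_tasks_self ..
    · refine ⟨ho.1, fun _ => ?_⟩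
      rw [ho.1]
      exact update_tasks_self ..

/-- A reader that goes at most one entry past the tasks sees either the genuine task or the
terminating `⊥`. Array entries are numbered from 1 and list positions from 0, whence the shift. -/
theorem TaskInv.getElem?_eq_some_of_task (h : TaskInv C xs) {k : ℕ} {x : ℕ+} (hk : k ≤ xs.length)
    (hx : C.mem (.tasks (k + 1)) = some x) : xs[k]? = some x := by
  rcases hk.lt_or_eq with hlt | rfl
  · have h1 := List.getElem?_eq_getElem hlt
    rw [h.written k _ h1] at hx
    rw [h1, hx]
  · rw [h.next] at hx
    cases hx

theorem TaskInv.eq_length_of_none (h : TaskInv C xs) {k : ℕ} (hk : k ≤ xs.length)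
    (hx : C.mem (.tasks (k + 1)) = none) : k = xs.length := by
  by_contra hne
  have h1 := List.getElem?_eq_getElem (lt_of_le_of_ne hk hne)
  rw [h.written k _ h1] at hx
  cases hx

theorem taskInv_init (hC : (wsWMult n).Initial C) : TaskInv C [] := by
  obtain ⟨⟨-, h1, h2⟩, h3⟩ := hC
  refine ⟨by simp, h1, fun i _ => ?_⟩
  rw [h3]
  exact ⟨rfl, h2⟩

theorem RMaxWrite.Step.tasks {m m' : Mem} {w w' : RMaxWrite} (h : w.Step m m' w') (k : ℕ) :
    m' (.tasks k) = m (.tasks k) := by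
  cases h
  · rfl
  · rfl
  · simp

/-- Invocations do not affect the list of the written tasks. -/
theorem TaskInv.inv (h : TaskInv C xs) {p : WSPers} {op : WSOp} (hi : C.proc i = .idle p) :
    TaskInv ⟨C.mem, Function.update C.proc i (.busy (WSCtl.start op p))⟩ xs := by
  refine h.frame (fun _ => rfl) fun hi0 => ?_
  have ho := h.owner i hi0
  rw [hi] at ho
  obtain ⟨h1, h2⟩ := ho
  cases op with
  | put x => exact ⟨congrArg (· + 1) h1, h2, by simp⟩
  | take => exact ⟨h1, h2⟩
  | steal => trivial

end Tasks

/-! ### Simulation by work-stealing with weak multiplicity -/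

section Weak

variable {n : ℕ} {xs : List ℕ+} {g : Fin n → ℕ} {i : Fin n} {q : WeakState n}

/-- The strings of the state `q` are what remains of `xs` if process `l` discards `g l` tasks. -/
structure WeakState.Drops (q : WeakState n) (xs : List ℕ+) (g : Fin n → ℕ) : Prop where
  eq : ∀ l, q.1 l = xs.drop (g l)
  le : ∀ l, g l ≤ xs.length

theorem drop_suffix_drop_of_le {α : Type*} (xs : List α) {a b : ℕ} (h : a ≤ b) :
    xs.drop b <:+ xs.drop a := by
  obtain ⟨d, rfl⟩ := Nat.exists_eq_add_of_le h
  rw [← List.drop_drop]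
  exact List.drop_suffix _ _

theorem drop_eq_cons_of_getElem? {α : Type*} {xs : List α} {k : ℕ} {x : α}
    (hx : xs[k]? = some x) : xs.drop k = x :: xs.drop (k + 1) := by
  have hlt := lt_length_of_getElem? hx
  rw [List.drop_eq_getElem_cons hlt]
  rw [List.getElem?_eq_getElem hlt] at hx
  cases hx
  rfl

theorem WeakState.exists_drops (xs : List ℕ+) {g : Fin n → ℕ} (hg : ∀ l, g l ≤ xs.length) :
    ∃ q : WeakState n, q.Drops xs g :=
  ⟨⟨fun l => xs.drop (g l), fun i j => (le_total (g i) (g j)).symm.imp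
    (drop_suffix_drop_of_le xs) (drop_suffix_drop_of_le xs)⟩, fun _ => rfl, hg⟩

theorem WeakState.Drops.isShortest (h : q.Drops xs g) {l : Fin n} (hl : ∀ j, g j ≤ g l) :
    q.IsShortest (xs.drop (g l)) := by
  refine ⟨⟨l, h.eq l⟩, fun j => ?_⟩
  rw [h.eq j, List.length_drop, List.length_drop]
  have := hl j
  omega

theorem WeakState.Drops.update_eq {q' : WeakState n} {k : ℕ} (h : q.Drops xs g)
    (h' : q'.Drops xs (Function.update g i k)) : q'.1 = Function.update q.1 i (xs.drop k) := by
  funext l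
  rw [h'.eq l]
  by_cases hl : l = i
  · subst hl; simp
  · simp [Function.update_of_ne hl, h.eq l]

theorem WeakState.Drops.update_le (h : q.Drops xs g) {k : ℕ} (hk : k ≤ xs.length) (l : Fin n) :
    Function.update g i k l ≤ xs.length := by
  by_cases hl : l = i
  · subst hl; simpa using hk
  · simpa [Function.update_of_ne hl] using h.le l

/-- `g i ≤ k` says that the task is still in the string of process `i`. That some process has
discarded at least `k` tasks makes the shortest string a suffix of `xs.drop k`, so the extraction
does not go past its first task. -/
theorem WeakState.Drops.extract_task (h : q.Drops xs g) {k : ℕ} {x : ℕ+} (hk : g i ≤ k)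
    (hx : xs[k]? = some x) (hb : ∃ l, k ≤ g l) :
    ∃ q', q.Extract i (.task x) q' ∧ q'.Drops xs (Function.update g i (k + 1)) := by
  have hlt := lt_length_of_getElem? hx
  obtain ⟨q', hq'⟩ := WeakState.exists_drops xs (h.update_le (i := i) (k := k + 1) hlt)
  have : Nonempty (Fin n) := ⟨i⟩
  obtain ⟨M, hM⟩ := Finite.exists_max g
  obtain ⟨l, hl⟩ := hb
  have hdrop := drop_eq_cons_of_getElem? hx
  refine ⟨q', .task (u := (xs.drop (g i)).take (k - g i)) (w := xs.drop (k + 1)) ?_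
    (h.isShortest hM) ?_ (h.update_eq hq'), hq'⟩
  · rw [h.eq i, ← hdrop]
    conv_lhs => rw [← List.take_append_drop (k - g i) (xs.drop (g i)), List.drop_drop,
      Nat.add_sub_cancel' hk]
  · rw [← hdrop]
    exact drop_suffix_drop_of_le xs (hl.trans (hM l))

/-- Some process has discarded everything, so the shortest string is empty. Either process `i` is in
that situation too, or it uses the choice `k = j` and gives up its remaining string. -/
theorem WeakState.Drops.extract_empty (h : q.Drops xs g) (hb : ∃ l, xs.length ≤ g l) :
    ∃ q', (q.1 i = [] ∧ q' = q ∨ q.Extract i .empty q') ∧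
      q'.Drops xs (Function.update g i xs.length) := by
  by_cases hi : q.1 i = []
  · have hgi : g i = xs.length := by
      rw [h.eq i, List.drop_eq_nil_iff] at hi
      exact (h.le i).antisymm hi
    refine ⟨q, Or.inl ⟨hi, rfl⟩, ?_⟩
    rwa [← hgi, Function.update_eq_self]
  · obtain ⟨q', hq'⟩ := WeakState.exists_drops xs (h.update_le (i := i) le_rfl)
    obtain ⟨l, hl⟩ := hb
    have hs := h.isShortest fun j => (h.le j).trans hl
    rw [List.drop_eq_nil_of_le hl] at hs
    refine ⟨q', Or.inr (.empty hi hs ?_), hq'⟩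
    simpa using h.update_eq hq'

theorem WeakState.Drops.put (h : q.Drops xs g) (x : ℕ+) (hi : i.val = 0) :
    ∃ q', WeakStep n q i (.put x) .ok q' ∧ q'.Drops (xs ++ [x]) g := by
  obtain ⟨q', hq'⟩ := WeakState.exists_drops (xs ++ [x]) (g := g) fun l => by
    simpa using (h.le l).trans (Nat.le_succ _)
  refine ⟨q', .put hi fun l => ?_, hq'⟩
  rw [hq'.eq l, h.eq l, List.drop_append_of_le_length (h.le l)]

/-- Some process has discarded all tasks before entry `v` of the array. -/
def Reached (g : Fin n → ℕ) (v : ℕ) : Prop := ∃ l, v ≤ g l + 1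

/-- The local variable `r` of process `i` is neither too low nor too high. -/
def WeakPers (g : Fin n → ℕ) (i : Fin n) (r : ℕ) : Prop := g i < r ∧ Reached g r

/-- Process `i` executes the call of `RMaxWrite` after its extraction. -/
def WeakRMax (g : Fin n → ℕ) (i : Fin n) : RMaxWrite → Prop
  | .read x r => x = g i + 1 ∧ Reached g r
  | .write x => x = g i + 1
  | .ret r => WeakPers g i r

/-- Relation between the control state of process `i` and the progress of its operation. -/
def WeakCtl (xs : List ℕ+) (g : Fin n → ℕ) (i : Fin n) : WSCtl → OpStatus WSOp WSRes → Prop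
  | .put p x dT _, st => i.val = 0 ∧ WeakPers g i p.r ∧
      st = if dT then .done (.put x) .ok else .todo (.put x)
  | .takeHead p, st => i.val = 0 ∧ WeakPers g i p.r ∧ st = .todo .take
  | .takeBody _ head x w, st => i.val = 0 ∧ WeakRMax g i w ∧ ∃ k y, head = k + 1 ∧
      xs[k]? = some y ∧ (∀ z, x = some z → z = some y) ∧ st = .done .take (.task y)
  | .stealHead p, st => i.val ≠ 0 ∧ WeakPers g i p.r ∧ st = .todo .steal
  | .stealTask p head, st => i.val ≠ 0 ∧ WeakPers g i p.r ∧ st = .todo .steal ∧ p.r = head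
  | .stealWrite _ x w, st => i.val ≠ 0 ∧ WeakRMax g i w ∧ st = .done .steal (.task x)
  | .retEmpty p, st => WeakPers g i p.r ∧ ∃ op, st = .done op .empty

def WeakIdle (g : Fin n → ℕ) (i : Fin n) (p : WSPers) : Prop := WeakPers g i p.r

def WeakLocal (xs : List ℕ+) (g : Fin n → ℕ) (i : Fin n) :
    (wsWMult n).Local → OpStatus WSOp WSRes → Prop
  | .idle p, st => st = .idle ∧ WeakIdle g i p
  | .busy c, st => WeakCtl xs g i c st

theorem Reached.mono {g' : Fin n → ℕ} (hg : g ≤ g') {v : ℕ} (h : Reached g v) : Reached g' v := by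
  obtain ⟨l, hl⟩ := h
  exact ⟨l, hl.trans (Nat.add_le_add_right (hg l) 1)⟩

theorem Reached.max {v w : ℕ} (hv : Reached g v) (hw : Reached g w) : Reached g (max v w) := by
  rcases max_choice v w with h | h <;> rwa [h]

theorem Reached.le (hq : q.Drops xs g) {k : ℕ} (h : Reached g (k + 1)) : k ≤ xs.length := by
  obtain ⟨l, hl⟩ := h
  exact (Nat.le_of_succ_le_succ hl).trans (hq.le l)

theorem WeakPers.mono {g' : Fin n → ℕ} (hg : g ≤ g') (hi : g' i = g i) {r : ℕ}
    (h : WeakPers g i r) : WeakPers g' i r :=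
  ⟨hi ▸ h.1, h.2.mono hg⟩

theorem WeakRMax.mono {g' : Fin n → ℕ} (hg : g ≤ g') (hi : g' i = g i) {w : RMaxWrite}
    (h : WeakRMax g i w) : WeakRMax g' i w := by
  cases w with
  | read x r => exact ⟨hi ▸ h.1, h.2.mono hg⟩
  | write x => exact h.trans (by rw [hi])
  | ret r => exact WeakPers.mono hg hi h

/-- Stability under the other processes: they may append tasks and raise their own counters. This
works because `r` is bounded above only through the growing maximum of `g`, and below only through
the process's own counter. -/
theorem WeakLocal.mono {xs' : List ℕ+} {g' : Fin n → ℕ} (hxs : xs <+: xs') (hg : g ≤ g')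
    (hi : g' i = g i) {loc : (wsWMult n).Local} {st : OpStatus WSOp WSRes}
    (h : WeakLocal xs g i loc st) : WeakLocal xs' g' i loc st := by
  rcases loc with p | (⟨p, x, dT, dB⟩ | p | ⟨p, head, x, w⟩ | p | ⟨p, head⟩ | ⟨p, x, w⟩ | p)
  · exact ⟨h.1, WeakPers.mono hg hi h.2⟩
  · exact ⟨h.1, h.2.1.mono hg hi, h.2.2⟩
  · exact ⟨h.1, h.2.1.mono hg hi, h.2.2⟩
  · obtain ⟨h1, h2, k, y, h3, h4, h5⟩ := h
    obtain ⟨t, rfl⟩ := hxs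
    exact ⟨h1, h2.mono hg hi, k, y, h3,
      (List.getElem?_append_left (lt_length_of_getElem? h4)).trans h4, h5⟩
  · exact ⟨h.1, h.2.1.mono hg hi, h.2.2⟩
  · exact ⟨h.1, h.2.1.mono hg hi, h.2.2⟩
  · exact ⟨h.1, h.2.1.mono hg hi, h.2.2⟩
  · exact ⟨WeakPers.mono hg hi h.1, h.2⟩

/-- The invariant that relates a configuration, the list `xs` of the written tasks, the numbers
`g l` of tasks discarded by the processes, and the progress of the operations. -/
structure WeakInv (C : (wsWMult n).Config) (xs : List ℕ+) (g : Fin n → ℕ)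
    (st : Fin n → OpStatus WSOp WSRes) : Prop where
  task : TaskInv C xs
  reached : Reached g (C.mem .R)
  locals : ∀ i, WeakLocal xs g i (C.proc i) (st i)

variable {C : (wsWMult n).Config} {st : Fin n → OpStatus WSOp WSRes}

theorem WeakInv.update (h : WeakInv C xs g st) {m' : Mem} {xs' : List ℕ+} {g' : Fin n → ℕ}
    {loc : (wsWMult n).Local} {s : OpStatus WSOp WSRes}
    (ht : TaskInv ⟨m', Function.update C.proc i loc⟩ xs')
    (hxs : xs <+: xs') (hg : g ≤ g') (hgi : ∀ j, j ≠ i → g' j = g j)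
    (hR : Reached g' (m' .R)) (hloc : WeakLocal xs' g' i loc s) :
    WeakInv ⟨m', Function.update C.proc i loc⟩ xs' g' (Function.update st i s) where
  task := ht
  reached := hR
  locals j := by
    by_cases hj : j = i
    · subst hj
      simpa using hloc
    · simpa only [Function.update_of_ne hj] using (h.locals j).mono hxs hg (hgi j hj)

theorem WeakInv.weakCtl (h : WeakInv C xs g st) {c : WSCtl} (hi : C.proc i = .busy c) :
    WeakCtl xs g i c (st i) := by
  have := h.locals i
  rwa [hi] at this

/-- The value written is `g i + 1`, reached by process `i` itself. No lower bound on `R` is kept, so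
overwriting a larger value does no harm; the process's own `r` prevents it from going back. -/
theorem WeakRMax.step {m m' : Mem} {w w' : RMaxWrite} (h : WeakRMax g i w)
    (hR : Reached g (m .R)) (hs : w.Step m m' w') : WeakRMax g i w' ∧ Reached g (m' .R) := by
  cases hs with
  | readLow hlt => exact ⟨h.1, hR⟩
  | readHigh hle =>
    obtain ⟨rfl, hr⟩ := h
    exact ⟨⟨hle, hr.max hR⟩, hR⟩
  | write =>
    rw [Function.update_self]
    have h : _ = g i + 1 := h
    subst h
    exact ⟨⟨Nat.lt_succ_self _, i, le_rfl⟩, i, le_rfl⟩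

theorem le_update {k : ℕ} (h : g i ≤ k) : g ≤ Function.update g i k :=
  le_update_iff.2 ⟨h, fun _ _ => le_rfl⟩

/-- A step of process `i` preserves the invariant, or it is the linearization point of its
operation. -/
theorem WeakInv.step (h : WeakInv C xs g st) (hq : q.Drops xs g) {c c' : WSCtl} {m' : Mem}
    (hi : C.proc i = .busy c) (hs : c.Step C.mem m' c') :
    WeakInv ⟨m', Function.update C.proc i (.busy c')⟩ xs g st ∨
    ∃ op v q' xs' g', st i = .todo op ∧ WeakStep n q i op v q' ∧ q'.Drops xs' g' ∧
      WeakInv ⟨m', Function.update C.proc i (.busy c')⟩ xs' g'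
        (Function.update st i (.done op v)) := by
  have hc := h.weakCtl hi
  -- `hsame` covers steps that are not linearization points; `hupd` covers extractions, which leave
  -- the memory alone and raise `g i`.
  have hsame : ∀ {xs' m'} (ht : TaskInv ⟨m', Function.update C.proc i (.busy c')⟩ xs')
      (hxs : xs <+: xs') (hR : Reached g (m' .R)) (hloc : WeakCtl xs' g i c' (st i)),
      WeakInv ⟨m', Function.update C.proc i (.busy c')⟩ xs' g st := by
    intro xs' m' ht hxs hR hloc
    have := h.update (s := st i) ht hxs le_rfl (fun _ _ => rfl) hR hloc
    rwa [Function.update_eq_self] at this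
  have hupd : ∀ {k op v}, g i ≤ k → (i.val = 0 → OwnerCtl C.mem xs c') →
      WeakCtl xs (Function.update g i k) i c' (.done op v) →
      WeakInv ⟨C.mem, Function.update C.proc i (.busy c')⟩ xs (Function.update g i k)
        (Function.update st i (.done op v)) := by
    intro k op v hk ho hloc
    exact h.update (h.task.frame (fun _ => rfl) ho) List.prefix_rfl (le_update hk)
      (fun j hj => Function.update_of_ne hj _ _) (h.reached.mono (le_update hk)) hloc
  cases hs with
  | putTask =>
    obtain ⟨h1, h2, h3⟩ := hc
    obtain ⟨q', hq1, hq2⟩ := hq.put _ h1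
    exact Or.inr ⟨_, _, q', _, g, h3, hq1, hq2, h.update (h.task.putTask h1 hi)
      (List.prefix_append _ _) le_rfl (fun _ _ => rfl) h.reached ⟨h1, h2, rfl⟩⟩
  | putBot =>
    exact Or.inl (hsame (h.task.putBot hc.1 hi) List.prefix_rfl h.reached hc)
  | @takeHead p hle =>
    obtain ⟨h1, h2, h3⟩ := hc
    have hr := h2.2.max h.reached
    have hlt : g i < max p.r (C.mem .R) := lt_max_of_lt_left h2.1
    obtain ⟨ho1, ho2⟩ := h.task.ownerCtl hi h1
    generalize max p.r (C.mem .R) = head at *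
    obtain ⟨k, rfl⟩ : ∃ k, head = k + 1 := ⟨head - 1, by omega⟩
    have hkx : k < xs.length := by omega
    have hx := List.getElem?_eq_getElem hkx
    -- `head ≤ tail` guarantees that the entry is already written, so the response is known before
    -- the array is read.
    obtain ⟨q', hq1, hq2⟩ := hq.extract_task (Nat.le_of_lt_succ hlt) hx
      (hr.imp fun l hl => Nat.le_of_succ_le_succ hl)
    refine Or.inr ⟨_, _, q', _, _, h3, .take h1 hq1, hq2, hupd hlt.le (fun _ => ⟨ho1, ho2⟩)
      ⟨h1, ⟨by simp, hr.mono (le_update hlt.le)⟩, k, _, rfl, hx, by simp, rfl⟩⟩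
  | @takeEmpty p hle =>
    obtain ⟨h1, h2, h3⟩ := hc
    have hr := h2.2.max h.reached
    have hlt : g i < max p.r (C.mem .R) := lt_max_of_lt_left h2.1
    obtain ⟨ho1, ho2⟩ := h.task.ownerCtl hi h1
    generalize max p.r (C.mem .R) = head at *
    obtain ⟨k, rfl⟩ : ∃ k, head = k + 1 := ⟨head - 1, by omega⟩
    -- The failed test gives `k ≥ |xs|`, and no process has discarded more than `|xs|` tasks.
    obtain rfl : k = xs.length := (hr.le hq).antisymm (by omega)
    obtain ⟨q', hq1, hq2⟩ := hq.extract_empty (i := i)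
      (hr.imp fun l hl => Nat.le_of_succ_le_succ hl)
    refine Or.inr ⟨_, .empty, q', _, _, h3, ?_, hq2, hupd (hq.le i) (fun _ => ⟨ho1, ho2⟩)
      ⟨⟨by simp, hr.mono (le_update (hq.le i))⟩, _, rfl⟩⟩
    rcases hq1 with ⟨hq1, rfl⟩ | hq1
    · exact .takeEmpty h1 hq1
    · exact .take h1 hq1
  | takeTask =>
    obtain ⟨h1, h2, k, y, rfl, h4, -, h6⟩ := hc
    exact Or.inl (hsame (h.task.frame (fun _ => rfl) fun h0 => h.task.ownerCtl hi h0)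
      List.prefix_rfl h.reached ⟨h1, h2, k, y, rfl, h4, by simp [h.task.written k y h4], h6⟩)
  | takeWrite hw =>
    obtain ⟨h1, h2, h3⟩ := hc
    obtain ⟨hw1, hw2⟩ := h2.step h.reached hw
    exact Or.inl (hsame (h.task.frame hw.tasks fun h0 => h.task.ownerCtl hi h0)
      List.prefix_rfl hw2 ⟨h1, hw1, h3⟩)
  | stealHead =>
    obtain ⟨h1, h2, h3⟩ := hc
    exact Or.inl (hsame (h.task.frame (fun _ => rfl) fun h0 => (h1 h0).elim)
      List.prefix_rfl h.reached
      ⟨h1, ⟨lt_max_of_lt_left h2.1, h2.2.max h.reached⟩, h3, rfl⟩)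
  | @stealTask p head x hx =>
    obtain ⟨h1, h2, h3, rfl⟩ := hc
    obtain ⟨hlt, hr⟩ := h2
    obtain ⟨k, hk⟩ : ∃ k, p.r = k + 1 := ⟨p.r - 1, by omega⟩
    rw [hk] at hx hlt hr
    have hxk := h.task.getElem?_eq_some_of_task (hr.le hq) hx
    obtain ⟨q', hq1, hq2⟩ := hq.extract_task (Nat.le_of_lt_succ hlt) hxk
      (hr.imp fun l hl => Nat.le_of_succ_le_succ hl)
    exact Or.inr ⟨_, _, q', _, _, h3, .steal h1 hq1, hq2, hupd hlt.le (fun h0 => (h1 h0).elim)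
      ⟨h1, ⟨by simp [hk], hk ▸ hr.mono (le_update hlt.le)⟩, rfl⟩⟩
  | @stealEmpty p head hx =>
    obtain ⟨h1, h2, h3, rfl⟩ := hc
    obtain ⟨hlt, hr⟩ := h2
    obtain ⟨k, hk⟩ : ∃ k, p.r = k + 1 := ⟨p.r - 1, by omega⟩
    rw [hk] at hx hlt hr
    -- Within the first `|xs| + 1` entries only the last is `⊥`, so some process has discarded all
    -- tasks.
    obtain rfl := h.task.eq_length_of_none (hr.le hq) hx
    obtain ⟨q', hq1, hq2⟩ := hq.extract_empty (i := i)
      (hr.imp fun l hl => Nat.le_of_succ_le_succ hl)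
    refine Or.inr ⟨_, .empty, q', _, _, h3, ?_, hq2, hupd (hq.le i) (fun h0 => (h1 h0).elim)
      ⟨⟨by simp [hk], hk ▸ hr.mono (le_update (hq.le i))⟩, _, rfl⟩⟩
    rcases hq1 with ⟨hq1, rfl⟩ | hq1
    · exact .stealEmpty h1 hq1
    · exact .steal h1 hq1
  | stealWrite hw =>
    obtain ⟨h1, h2, h3⟩ := hc
    obtain ⟨hw1, hw2⟩ := h2.step h.reached hw
    exact Or.inl (hsame (h.task.frame hw.tasks fun h0 => h.task.ownerCtl hi h0)
      List.prefix_rfl hw2 ⟨h1, hw1, h3⟩)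

theorem WSCtl.out_cases {c : WSCtl} {v : WSRes} {p' : WSPers} (h : c.out = some (v, p')) :
    (∃ p x, c = .put p x true true ∧ v = .ok ∧ p' = p) ∨
    (∃ p head y r, c = .takeBody p head (some y) (.ret r) ∧
      v = (y.elim .empty .task : WSRes) ∧ p' = { p with r := r }) ∨
    (∃ p x r, c = .stealWrite p x (.ret r) ∧ v = .task x ∧ p' = { p with r := r }) ∨
    (∃ p, c = .retEmpty p ∧ v = .empty ∧ p' = p) := by
  rcases c with ⟨p, x, _ | _, _ | _⟩ | p | ⟨p, head, _ | _ | x, w | w | w⟩ | p | ⟨p, head⟩ |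
    ⟨p, x, w | w | w⟩ | p <;> cases h <;> simp

/-- `OwnerCtl` records nothing about `stealWrite`, so `hsteal` has to exclude that the owner returns
from it. When a `Put` returns, its completed `⊥` write restores the spare cell. -/
theorem TaskInv.res (h : TaskInv C xs) {c : WSCtl} {v : WSRes} {p' : WSPers}
    (hi : C.proc i = .busy c) (hv : c.out = some (v, p'))
    (hsteal : ∀ p x w, c = .stealWrite p x w → i.val ≠ 0) :
    TaskInv ⟨C.mem, Function.update C.proc i (.idle p')⟩ xs := by
  refine h.frame (fun _ => rfl) fun h0 => ?_
  have ho := h.ownerCtl hi h0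
  rcases WSCtl.out_cases hv with ⟨p, x, rfl, rfl, rfl⟩ | ⟨p, head, y, r, rfl, rfl, rfl⟩ |
    ⟨p, x, r, rfl, rfl, rfl⟩ | ⟨p, rfl, rfl, rfl⟩
  · exact ⟨ho.1, ho.2 rfl⟩
  · exact ho
  · exact (hsteal _ _ _ rfl h0).elim
  · exact ho

theorem WeakInv.res (h : WeakInv C xs g st) {c : WSCtl} {v : WSRes} {p' : WSPers}
    (hi : C.proc i = .busy c) (hv : c.out = some (v, p')) :
    ∃ op, st i = .done op v ∧ WeakInv ⟨C.mem, Function.update C.proc i (.idle p')⟩ xs g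
      (Function.update st i .idle) := by
  have hc := h.weakCtl hi
  have ht := h.task.res hi hv (by rintro p x w rfl; exact hc.1)
  have hupd : WeakIdle g i p' → WeakInv ⟨C.mem, Function.update C.proc i (.idle p')⟩ xs g
      (Function.update st i .idle) := fun hp =>
    h.update ht List.prefix_rfl le_rfl (fun _ _ => rfl) h.reached ⟨rfl, hp⟩
  rcases WSCtl.out_cases hv with ⟨p, x, rfl, rfl, rfl⟩ | ⟨p, head, y, r, rfl, rfl, rfl⟩ |
    ⟨p, x, r, rfl, rfl, rfl⟩ | ⟨p, rfl, rfl, rfl⟩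
  · exact ⟨_, hc.2.2, hupd hc.2.1⟩
  · obtain ⟨h1, h2, k, z, -, -, h5, h6⟩ := hc
    -- The value read from the array is the task announced at the linearization point; in particular
    -- it is not `⊥`.
    obtain rfl := h5 y rfl
    exact ⟨_, h6, hupd h2⟩
  · exact ⟨_, hc.2.2, hupd hc.2.1⟩
  · exact ⟨_, hc.2.choose_spec, hupd hc.1⟩

theorem WeakInv.inv (h : WeakInv C xs g st) {p : WSPers} {op : WSOp} (hi : C.proc i = .idle p)
    (hop : op.MayInvoke i) :
    st i = .idle ∧ WeakInv ⟨C.mem, Function.update C.proc i (.busy (WSCtl.start op p))⟩ xs g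
      (Function.update st i (.todo op)) := by
  have hl := h.locals i
  rw [hi] at hl
  refine ⟨hl.1, h.update (h.task.inv hi) List.prefix_rfl le_rfl (fun _ _ => rfl) h.reached ?_⟩
  cases op with
  | put x => exact ⟨hop, hl.2, rfl⟩
  | take => exact ⟨hop, hl.2, rfl⟩
  | steal => exact ⟨hop, hl.2, rfl⟩

theorem weakInv_init (hn : 0 < n) (hC : (wsWMult n).Initial C) :
    WeakInv C [] (fun _ => 0) fun _ => .idle where
  task := taskInv_init hC
  reached := ⟨⟨0, hn⟩, hC.1.1.le⟩
  locals i := by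
    rw [hC.2]
    exact ⟨rfl, Nat.one_pos, i, le_rfl⟩

theorem wsWMult_simulation_weak (hn : 0 < n) :
    (wsWMult n).Simulation (weakWorkStealing n) False fun C q st =>
      ∃ xs g, WeakState.Drops q xs g ∧ WeakInv C xs g st where
  init C hC := ⟨[], fun _ => 0, ⟨fun _ => rfl, fun _ => le_rfl⟩, weakInv_init hn hC⟩
  inv C q st i p op h _ hi hop := by
    obtain ⟨xs, g, hq, h⟩ := h
    obtain ⟨h1, h2⟩ := h.inv hi hop
    exact ⟨h1, xs, g, hq, h2⟩
  step C q st i c a h hi ha := by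
    obtain ⟨xs, g, hq, h⟩ := h
    rcases h.step hq hi (WSCtl.step_of_mem_instr C.mem ha) with
      h1 | ⟨op, v, q', xs', g', h1, h2, h3, h4⟩
    · exact Or.inl ⟨xs, g, hq, h1⟩
    · exact Or.inr ⟨op, v, q', h1, h2, xs', g', h3, h4⟩
  res C q st i c v p h hi hv := by
    obtain ⟨xs, g, hq, h⟩ := h
    obtain ⟨op, h1, h2⟩ := h.res hi hv
    exact ⟨op, h1, xs, g, hq, h2⟩

end Weak


/-! ### Simulation by exact FIFO work-stealing in the absence of concurrency -/

section Sequential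

variable {n : ℕ} {xs : List ℕ+} {g R : ℕ} {i : Fin n}

/-- The call of `RMaxWrite` after the extraction of the `g`-th task, if the register contains
`R`. -/
def SeqRMax (g R : ℕ) : RMaxWrite → Prop
  | .read x r => x = g + 1 ∧ r = g ∧ R = g
  | .write x => x = g + 1
  | .ret r => r = g + 1 ∧ R = g + 1

/-- Relation between the control state of process `i` and the progress of its operation, if no other
process executes an operation. -/
def SeqCtl (xs : List ℕ+) (g R : ℕ) (i : Fin n) : WSCtl → OpStatus WSOp WSRes → Prop
  | .put p x dT _, st => i.val = 0 ∧ p.r ≤ g + 1 ∧ R = g + 1 ∧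
      st = if dT then .done (.put x) .ok else .todo (.put x)
  | .takeHead p, st => i.val = 0 ∧ p.r ≤ g + 1 ∧ R = g + 1 ∧ st = .todo .take
  | .takeBody _ head x w, st => i.val = 0 ∧ SeqRMax g R w ∧ ∃ k y, head = k + 1 ∧
      xs[k]? = some y ∧ (∀ z, x = some z → z = some y) ∧ st = .done .take (.task y)
  | .stealHead p, st => i.val ≠ 0 ∧ p.r ≤ g + 1 ∧ R = g + 1 ∧ st = .todo .steal
  | .stealTask p head, st => i.val ≠ 0 ∧ p.r = g + 1 ∧ R = g + 1 ∧ st = .todo .steal ∧ head = g + 1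
  | .stealWrite _ x w, st => i.val ≠ 0 ∧ SeqRMax g R w ∧ st = .done .steal (.task x)
  | .retEmpty p, st => p.r ≤ g + 1 ∧ R = g + 1 ∧ ∃ op, st = .done op .empty

def SeqIdle (g : ℕ) (p : WSPers) : Prop := p.r ≤ g + 1

def SeqLocal (xs : List ℕ+) (g R : ℕ) (i : Fin n) :
    (wsWMult n).Local → OpStatus WSOp WSRes → Prop
  | .idle p, st => st = .idle ∧ SeqIdle g p ∧ R = g + 1
  | .busy c, st => SeqCtl xs g R i c st

/-- The invariant in the absence of concurrency: `g` of the written tasks `xs` have been extracted,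
and no process except possibly `i` executes an operation. -/
structure SeqInv (C : (wsWMult n).Config) (xs : List ℕ+) (g : ℕ) (i : Fin n)
    (st : Fin n → OpStatus WSOp WSRes) : Prop where
  task : TaskInv C xs
  le : g ≤ xs.length
  idle : ∀ j, j ≠ i → st j = .idle ∧ ∃ p, C.proc j = .idle p ∧ SeqIdle g p
  current : SeqLocal xs g (C.mem .R) i (C.proc i) (st i)

variable {C : (wsWMult n).Config} {st : Fin n → OpStatus WSOp WSRes}

theorem SeqInv.update (h : SeqInv C xs g i st) {m' : Mem} {xs' : List ℕ+} {g' : ℕ}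
    {loc : (wsWMult n).Local} {s : OpStatus WSOp WSRes}
    (ht : TaskInv ⟨m', Function.update C.proc i loc⟩ xs') (hle : g' ≤ xs'.length)
    (hg : g ≤ g') (hloc : SeqLocal xs' g' (m' .R) i loc s) :
    SeqInv ⟨m', Function.update C.proc i loc⟩ xs' g' i (Function.update st i s) where
  task := ht
  le := hle
  idle j hj := by
    obtain ⟨h1, p, h2, h3⟩ := h.idle j hj
    simp only [Function.update_of_ne hj]
    exact ⟨h1, p, h2, h3.trans (Nat.add_le_add_right hg 1)⟩
  current := by simpa using hloc

theorem SeqInv.eq_of_busy (h : SeqInv C xs g i st) {j : Fin n} {c : WSCtl}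
    (hj : C.proc j = .busy c) : j = i := by
  by_contra hne
  obtain ⟨-, p, hp, -⟩ := h.idle j hne
  rw [hj] at hp
  cases hp

theorem SeqInv.seqCtl (h : SeqInv C xs g i st) {c : WSCtl} (hi : C.proc i = .busy c) :
    SeqCtl xs g (C.mem .R) i c (st i) := by
  have := h.current
  rwa [hi] at this

/-- Nobody else writes `R`, so it still contains the old value `g`, the test `x > r` succeeds and
the write takes place, which restores `R = g + 1`. -/
theorem SeqRMax.step {m m' : Mem} {w w' : RMaxWrite} (h : SeqRMax g (m .R) w)
    (hs : w.Step m m' w') : SeqRMax g (m' .R) w' := by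
  cases hs with
  | readLow hlt => exact h.1
  | readHigh hle =>
    obtain ⟨rfl, rfl, h3⟩ := h
    rw [h3, max_self] at hle
    omega
  | write =>
    rw [Function.update_self]
    have h : _ = g + 1 := h
    exact ⟨h, h⟩

/-- A step preserves the invariant, or it is the linearization point of the current operation. -/
theorem SeqInv.step (h : SeqInv C xs g i st) {c c' : WSCtl} {m' : Mem}
    (hi : C.proc i = .busy c) (hs : c.Step C.mem m' c') :
    SeqInv ⟨m', Function.update C.proc i (.busy c')⟩ xs g i st ∨
    ∃ op v xs' g', st i = .todo op ∧ FifoStep n (xs.drop g) i op v (xs'.drop g') ∧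
      SeqInv ⟨m', Function.update C.proc i (.busy c')⟩ xs' g' i
        (Function.update st i (.done op v)) := by
  have hc := h.seqCtl hi
  have hsame : ∀ {m'} (ht : TaskInv ⟨m', Function.update C.proc i (.busy c')⟩ xs)
      (hloc : SeqCtl xs g (m' .R) i c' (st i)),
      SeqInv ⟨m', Function.update C.proc i (.busy c')⟩ xs g i st := by
    intro m' ht hloc
    have := h.update (s := st i) ht h.le le_rfl hloc
    rwa [Function.update_eq_self] at this
  cases hs with
  | putTask =>
    obtain ⟨h1, h2, h3, h4⟩ := hc
    refine Or.inr ⟨_, _, _, g, h4, ?_, h.update (h.task.putTask h1 hi)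
      (by simpa using h.le.trans (Nat.le_succ _)) le_rfl ⟨h1, h2, h3, rfl⟩⟩
    rw [List.drop_append_of_le_length h.le]
    exact .put h1
  | putBot =>
    exact Or.inl (hsame (h.task.putBot hc.1 hi) hc)
  | @takeHead p hle =>
    obtain ⟨h1, h2, h3, h4⟩ := hc
    -- `R` is exact and no local `r` exceeds it, so the head is the true first position.
    have hm : max p.r (C.mem .R) = g + 1 := by rw [h3]; exact max_eq_right h2
    obtain ⟨ho1, ho2⟩ := h.task.ownerCtl hi h1
    rw [hm] at *
    have hgx : g < xs.length := by omega
    have hx := List.getElem?_eq_getElem hgx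
    refine Or.inr ⟨_, _, xs, g + 1, h4, ?_, h.update
      (h.task.frame (fun _ => rfl) fun _ => ⟨ho1, ho2⟩) hgx (Nat.le_succ _)
      ⟨h1, ⟨rfl, rfl, h3⟩, g, _, rfl, hx, by simp, rfl⟩⟩
    rw [drop_eq_cons_of_getElem? hx]
    exact .take h1
  | @takeEmpty p hlt =>
    obtain ⟨h1, h2, h3, h4⟩ := hc
    have hm : max p.r (C.mem .R) = g + 1 := by rw [h3]; exact max_eq_right h2
    obtain ⟨ho1, ho2⟩ := h.task.ownerCtl hi h1
    rw [hm] at *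
    have hgx : xs.length ≤ g := by omega
    refine Or.inr ⟨_, .empty, xs, g, h4, ?_, h.update
      (h.task.frame (fun _ => rfl) fun _ => ⟨ho1, ho2⟩) h.le le_rfl ⟨le_rfl, h3, _, rfl⟩⟩
    rw [List.drop_eq_nil_of_le hgx]
    exact .takeEmpty h1
  | takeTask =>
    obtain ⟨h1, h2, k, y, rfl, h4, -, h6⟩ := hc
    exact Or.inl (hsame (h.task.frame (fun _ => rfl) fun h0 => h.task.ownerCtl hi h0)
      ⟨h1, h2, k, y, rfl, h4, by simp [h.task.written k y h4], h6⟩)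
  | takeWrite hw =>
    exact Or.inl (hsame (h.task.frame hw.tasks fun h0 => h.task.ownerCtl hi h0)
      ⟨hc.1, hc.2.1.step hw, hc.2.2⟩)
  | @stealHead p =>
    obtain ⟨h1, h2, h3, h4⟩ := hc
    have hm : max p.r (C.mem .R) = g + 1 := by rw [h3]; exact max_eq_right h2
    exact Or.inl (hsame (h.task.frame (fun _ => rfl) fun h0 => (h1 h0).elim) ⟨h1, hm, h3, h4, hm⟩)
  | stealTask hx =>
    obtain ⟨h1, h2, h3, h4, rfl⟩ := hc
    have hxg := h.task.getElem?_eq_some_of_task h.le hx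
    refine Or.inr ⟨_, _, xs, g + 1, h4, ?_, h.update
      (h.task.frame (fun _ => rfl) fun h0 => (h1 h0).elim) (lt_length_of_getElem? hxg)
      (Nat.le_succ _) ⟨h1, ⟨rfl, h2, h3⟩, rfl⟩⟩
    rw [drop_eq_cons_of_getElem? hxg]
    exact .steal h1
  | stealEmpty hx =>
    obtain ⟨h1, h2, h3, h4, rfl⟩ := hc
    have hgx := h.task.eq_length_of_none h.le hx
    refine Or.inr ⟨_, .empty, xs, g, h4, ?_, h.update
      (h.task.frame (fun _ => rfl) fun h0 => (h1 h0).elim) h.le le_rfl ⟨h2.le, h3, _, rfl⟩⟩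
    rw [List.drop_eq_nil_of_le hgx.ge]
    exact .stealEmpty h1
  | stealWrite hw =>
    exact Or.inl (hsame (h.task.frame hw.tasks fun h0 => h.task.ownerCtl hi h0)
      ⟨hc.1, hc.2.1.step hw, hc.2.2⟩)

theorem SeqInv.res (h : SeqInv C xs g i st) {c : WSCtl} {v : WSRes} {p' : WSPers}
    (hi : C.proc i = .busy c) (hv : c.out = some (v, p')) :
    ∃ op, st i = .done op v ∧ SeqInv ⟨C.mem, Function.update C.proc i (.idle p')⟩ xs g i
      (Function.update st i .idle) := by
  have hc := h.seqCtl hi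
  have ht := h.task.res hi hv (by rintro p x w rfl; exact hc.1)
  have hupd : p'.r ≤ g + 1 → C.mem .R = g + 1 →
      SeqInv ⟨C.mem, Function.update C.proc i (.idle p')⟩ xs g i
      (Function.update st i .idle) := fun hp hR => h.update ht h.le le_rfl ⟨rfl, hp, hR⟩
  rcases WSCtl.out_cases hv with ⟨p, x, rfl, rfl, rfl⟩ | ⟨p, head, y, r, rfl, rfl, rfl⟩ |
    ⟨p, x, r, rfl, rfl, rfl⟩ | ⟨p, rfl, rfl, rfl⟩
  · exact ⟨_, hc.2.2.2, hupd hc.2.1 hc.2.2.1⟩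
  · obtain ⟨h1, ⟨h2, h3⟩, k, z, -, -, h5, h6⟩ := hc
    obtain rfl := h5 y rfl
    exact ⟨_, h6, hupd h2.le h3⟩
  · exact ⟨_, hc.2.2, hupd hc.2.1.1.le hc.2.1.2⟩
  · exact ⟨_, hc.2.2.choose_spec, hupd hc.1 hc.2.1⟩

/-- If no operation is executed, any process can be taken for the current one. -/
theorem SeqInv.change_current (h : SeqInv C xs g i st) (hst : ∀ j, st j = .idle) (j : Fin n) :
    SeqInv C xs g j st := by
  have hcur := h.current
  rw [hst i] at hcur
  obtain ⟨p, hp, hpr, hR⟩ : ∃ p, C.proc i = .idle p ∧ SeqIdle g p ∧ C.mem .R = g + 1 := by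
    rcases hloc : C.proc i with p | c <;> rw [hloc] at hcur
    · exact ⟨p, rfl, hcur.2⟩
    · exfalso
      rcases c with ⟨p, x, _ | _, dB⟩ | p | ⟨p, head, x, w⟩ | p | ⟨p, head⟩ | ⟨p, x, w⟩ | p <;>
      simp [SeqLocal, SeqCtl] at hcur
  have hall : ∀ l, ∃ p, C.proc l = .idle p ∧ SeqIdle g p := by
    intro l
    by_cases hl : l = i
    · subst hl
      exact ⟨p, hp, hpr⟩
    · exact (h.idle l hl).2
  refine ⟨h.task, h.le, fun l _ => ⟨hst l, hall l⟩, ?_⟩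
  obtain ⟨p, hp, hpr⟩ := hall j
  rw [hp, hst j]
  exact ⟨rfl, hpr, hR⟩

theorem SeqInv.inv (h : SeqInv C xs g i st) {p : WSPers} {op : WSOp} (hi : C.proc i = .idle p)
    (hop : op.MayInvoke i) :
    SeqInv ⟨C.mem, Function.update C.proc i (.busy (WSCtl.start op p))⟩ xs g i
      (Function.update st i (.todo op)) := by
  have hl := h.current
  rw [hi] at hl
  refine h.update (h.task.inv hi) h.le le_rfl ?_
  cases op with
  | put x => exact ⟨hop, hl.2.1, hl.2.2, rfl⟩
  | take => exact ⟨hop, hl.2.1, hl.2.2, rfl⟩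
  | steal => exact ⟨hop, hl.2.1, hl.2.2, rfl⟩

theorem seqInv_init (hC : (wsWMult n).Initial C) (i : Fin n) :
    SeqInv C [] 0 i fun _ => .idle where
  task := taskInv_init hC
  le := le_rfl
  idle j _ := ⟨rfl, _, hC.2 j, le_rfl⟩
  current := by
    rw [hC.2]
    exact ⟨rfl, le_rfl, hC.1.1⟩

theorem wsWMult_simulation_fifo (hn : 0 < n) :
    (wsWMult n).Simulation (fifoWorkStealing n) True fun C q st =>
      ∃ xs g i, q = xs.drop g ∧ SeqInv C xs g i st where
  init C hC := ⟨[], 0, ⟨0, hn⟩, rfl, seqInv_init hC _⟩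
  inv C q st i p op h hst hi hop := by
    obtain ⟨xs, g, j, hq, h⟩ := h
    -- No operation is running, so the invoking process can take over the role of the current one.
    exact ⟨hst trivial i, xs, g, i, hq, (h.change_current (hst trivial) i).inv hi hop⟩
  step C q st i c a h hi ha := by
    obtain ⟨xs, g, j, rfl, h⟩ := h
    obtain rfl := h.eq_of_busy hi
    rcases h.step hi (WSCtl.step_of_mem_instr C.mem ha) with
      h1 | ⟨op, v, xs', g', h1, h2, h3⟩
    · exact Or.inl ⟨xs, g, i, rfl, h1⟩
    · exact Or.inr ⟨op, v, _, h1, h2, xs', g', i, rfl, h3⟩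
  res C q st i c v p h hi hv := by
    obtain ⟨xs, g, j, hq, h⟩ := h
    obtain rfl := h.eq_of_busy hi
    obtain ⟨op, h1, h2⟩ := h.res hi hv
    exact ⟨op, h1, xs, g, i, hq, h2⟩

end Sequential

end WorkStealing

theorem mainTheorem1 :
    ∃ c : ℕ, ∀ n : ℕ, 2 ≤ n →
      (WorkStealing.wsWMult n).FullyReadWrite ∧
      (WorkStealing.wsWMult n).FenceFree ∧
      (WorkStealing.wsWMult n).WaitFree ∧
      (WorkStealing.wsWMult n).SequentiallyExact (WorkStealing.fifoWorkStealing n) ∧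
      (WorkStealing.wsWMult n).Linearizable (WorkStealing.weakWorkStealing n) ∧
      (WorkStealing.wsWMult n).StepComplexityLE c := by
  refine ⟨4, fun n hn => ?_⟩
  have hn : 0 < n := by omega
  exact ⟨WorkStealing.wsWMult_fullyReadWrite n, WorkStealing.wsWMult_fenceFree n,
    WorkStealing.wsWMult_waitFree n, (WorkStealing.wsWMult_simulation_fifo hn).sequentiallyExact,
    (WorkStealing.wsWMult_simulation_weak hn).linearizable,
    WorkStealing.wsWMult_stepComplexityLE n⟩
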